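/- Let $R$ be a commutative ring with unit, let $n\ge 0$, and let $S=R[X_1,\ldots,X_n]$ be the polynomial ring with its $\mathbb{Z}^n$-grading $\deg X_i=\varepsilon_i$ (the $i$-th standard basis vector). For $a,b\in\mathbb{Z}^n$ put $|a|=a_1+\cdots+a_n$, and write $b\preceq a$ if $b_i\le a_i$ for all $i$. A $\mathbb{Z}^n$-graded $S$-module $M=\bigoplus_{a\in\mathbb{Z}^n}M_a$ is called bounded below if there is $c\in\mathbb{Z}$ with $M_a=0$ for all $a\in\mathbb{Z}^n$ with $|a|\le c$. For $\mathbb{Z}^n$-graded $S$-modules $M,N$, the module $\operatorname{Tor}_i^S(M,N)$ carries its natural $\mathbb{Z}^n$-grading, induced by a $\mathbb{Z}^n$-graded projective resolution of $N$; $\operatorname{Tor}_i^S(M,N)_a$ denotes its component of degree $a$. Let $M,N$ be bounded below $\mathbb{Z}^n$-graded $S$-modules. (1) Assume that $M$ or $N$ is flat as an $R$-module. If $p\ge 0$ and $\operatorname{Tor}_p^S(M,N)_a\ne 0$ for some $a\in\mathbb{Z}^n$, then for every $i\in\{0,\ldots,p\}$ there are at least $\binom{p}{i}$ distinct $b\in\mathbb{Z}^n$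 with $b\preceq a$, $|b|\le |a|-p+i$ and $\operatorname{Tor}_i^S(M,N)_b\ne 0$. (2) In particular, if $R=K$ is a field and $\operatorname{Tor}_p^S(M,N)\ne 0$ for some $p\ge 0$, then $\dim_K\operatorname{Tor}_i^S(M,N)\ge\binom{p}{i}$ for every $i\in\{0,\ldots,p\}$. -/

import Mathlib

open CategoryTheory MvPolynomial
open scoped TensorProduct

universe u

noncomputable section

namespace ZnGraded

/-- The polynomial ring `S = R[X_1, …, X_n]`. -/
abbrev Poly (R : Type u) [CommRing R] (n : ℕ) : Type u := MvPolynomial (Fin n) R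

/-- The `ℤ^n`-grading of `S` with `deg X_i = ε_i`. -/
def polyGrading (R : Type u) [CommRing R] (n : ℕ) :
    (Fin n → ℤ) → Submodule R (Poly R n) :=
  weightedHomogeneousSubmodule R (fun i : Fin n => (Pi.single i 1 : Fin n → ℤ))

/-- `|a| = a_1 + ⋯ + a_n`. -/
def total {n : ℕ} (a : Fin n → ℤ) : ℤ := ∑ i, a i

/-- The additive subgroups `𝓜 a` make the `S`-module `M` a `ℤ^n`-graded `S`-module:
`M = ⨁ₐ 𝓜 a` and `S_a • 𝓜 b ⊆ 𝓜 (a + b)`. -/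
structure IsGradedModule (R : Type u) [CommRing R] {n : ℕ} {M : Type u} [AddCommGroup M]
    [Module (Poly R n) M] (𝓜 : (Fin n → ℤ) → AddSubgroup M) : Prop where
  isInternal : DirectSum.IsInternal 𝓜
  gradedSMul : SetLike.GradedSMul (polyGrading R n) 𝓜

/-- `M_a = 0` whenever `|a| ≤ c`, for some integer `c`. -/
def IsBoundedBelow {n : ℕ} {M : Type u} [AddCommGroup M]
    (𝓜 : (Fin n → ℤ) → AddSubgroup M) : Prop :=
  ∃ c : ℤ, ∀ a : Fin n → ℤ, total a ≤ c → 𝓜 a = ⊥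

/-- The degree `a` part of `M ⊗_S P` for `ℤ^n`-graded `S`-modules `M` and `P`: it is generated by
the `m ⊗ x` with `m ∈ M_b`, `x ∈ P_c` and `b + c = a`. -/
def tensorGrading {R : Type u} [CommRing R] {n : ℕ} {M P : Type u} [AddCommGroup M]
    [Module (Poly R n) M] [AddCommGroup P] [Module (Poly R n) P]
    (𝓜 : (Fin n → ℤ) → AddSubgroup M) (𝓟 : (Fin n → ℤ) → AddSubgroup P) (a : Fin n → ℤ) :
    AddSubgroup (M ⊗[Poly R n] P) :=
  AddSubgroup.closure {t | ∃ b c : Fin n → ℤ, b + c = a ∧ ∃ m ∈ 𝓜 b, ∃ x ∈ 𝓟 c,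
    t = m ⊗ₜ[Poly R n] x}

/-- A `ℤ^n`-graded projective resolution of the graded module `N`: a projective resolution whose
terms are graded modules and whose differentials and augmentation preserve degrees. -/
structure GradedResolution {R : Type u} [CommRing R] {n : ℕ} {N : Type u} [AddCommGroup N]
    [Module (Poly R n) N] (𝓝 : (Fin n → ℤ) → AddSubgroup N) where
  /-- the underlying projective resolution -/
  res : ProjectiveResolution (ModuleCat.of (Poly R n) N)
  /-- the gradings of its terms -/
  grading : ∀ i : ℕ, (Fin n → ℤ) → AddSubgroup (res.complex.X i)
  isGraded : ∀ i : ℕ, IsGradedModule R (grading i)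
  d_mem : ∀ (i j : ℕ) (a : Fin n → ℤ) (x : res.complex.X i),
    x ∈ grading i a → (res.complex.d i j).hom x ∈ grading j a
  π_mem : ∀ (a : Fin n → ℤ) (x : res.complex.X 0),
    x ∈ grading 0 a → (show N from (res.π.f 0).hom x) ∈ 𝓝 a

/-! ### Existence of graded resolutions -/

section Existence

variable {R : Type u} [CommRing R] {n : ℕ}

/-- A criterion for a family of subgroups to be an internal direct sum. -/
lemma isInternal_of_proj {M : Type u} [AddCommGroup M] (𝓜 : (Fin n → ℤ) → AddSubgroup M)
    (p : (Fin n → ℤ) → M →+ M) (hsame : ∀ a, ∀ x ∈ 𝓜 a, p a x = x)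
    (hne : ∀ a b, a ≠ b → ∀ x ∈ 𝓜 a, p b x = 0)
    (hspan : ∀ x : M, x ∈ (DirectSum.coeAddMonoidHom 𝓜).range) :
    DirectSum.IsInternal 𝓜 := by
  have key : ∀ (b : Fin n → ℤ) (g : DirectSum (Fin n → ℤ) fun a => 𝓜 a),
      p b (DirectSum.coeAddMonoidHom 𝓜 g) = g b := by
    intro b g
    induction g using DirectSum.induction_on with
    | zero => simp
    | of a x =>
      rw [DirectSum.coeAddMonoidHom_of]
      by_cases h : a = b
      · subst h
        rw [hsame a _ x.2, DirectSum.of_eq_same]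
      · rw [hne a b h _ x.2, DirectSum.of_eq_of_ne _ _ _ (Ne.symm h)]
        rfl
    | add x y hx hy => simp [hx, hy]
  refine ⟨?_, fun x => hspan x⟩
  rw [injective_iff_map_eq_zero]
  intro g hg
  ext b
  rw [← key b g, hg]
  simp

/-- The grading of the free module on the homogeneous elements of a graded module, in which the
basis element of a homogeneous element of degree `b` has degree `b`. -/
def coverGrading {G : Type u} [AddCommGroup G] (𝓖 : (Fin n → ℤ) → AddSubgroup G)
    (a : Fin n → ℤ) : AddSubgroup ((Σ b, 𝓖 b) →₀ Poly R n) where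
  carrier := {f | ∀ s, f s ∈ polyGrading R n (a - s.1)}
  add_mem' hf hg s := add_mem (hf s) (hg s)
  zero_mem' _ := zero_mem _
  neg_mem' hf s := neg_mem (hf s)

/-- The free module on the homogeneous elements of `G` maps onto `G`. -/
def coverMap {G : Type u} [AddCommGroup G] [Module (Poly R n) G]
    (𝓖 : (Fin n → ℤ) → AddSubgroup G) : ((Σ b, 𝓖 b) →₀ Poly R n) →ₗ[Poly R n] G :=
  Finsupp.linearCombination (Poly R n) (fun s => (s.2 : G))

lemma smul_mem_of_eq {G : Type u} [AddCommGroup G] [Module (Poly R n) G]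
    {𝓖 : (Fin n → ℤ) → AddSubgroup G} (h : IsGradedModule R 𝓖) {a b c : Fin n → ℤ}
    (hc : a + b = c) {f : Poly R n} (hf : f ∈ polyGrading R n a) {x : G} (hx : x ∈ 𝓖 b) :
    f • x ∈ 𝓖 c := by
  subst hc
  exact h.gradedSMul.smul_mem hf hx

lemma coverMap_mem {G : Type u} [AddCommGroup G] [Module (Poly R n) G]
    {𝓖 : (Fin n → ℤ) → AddSubgroup G} (h : IsGradedModule R 𝓖) (a : Fin n → ℤ)
    (f : (Σ b, 𝓖 b) →₀ Poly R n) (hf : f ∈ coverGrading 𝓖 a) : coverMap 𝓖 f ∈ 𝓖 a := by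
  rw [coverMap, Finsupp.linearCombination_apply, Finsupp.sum]
  exact sum_mem fun s _ => smul_mem_of_eq h (sub_add_cancel a s.1) (hf s) s.2.2

lemma coverMap_surjective {G : Type u} [AddCommGroup G] [Module (Poly R n) G]
    {𝓖 : (Fin n → ℤ) → AddSubgroup G} (h : IsGradedModule R 𝓖) :
    Function.Surjective (coverMap (R := R) 𝓖) := by
  intro x
  obtain ⟨g, rfl⟩ := h.isInternal.2 x
  induction g using DirectSum.induction_on with
  | zero => exact ⟨0, by simp⟩
  | of a x => exact ⟨Finsupp.single ⟨a, x⟩ 1, by simp [coverMap]⟩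
  | add x y hx hy =>
    obtain ⟨f, hf⟩ := hx
    obtain ⟨g, hg⟩ := hy
    exact ⟨f + g, by rw [map_add, map_add, hf, hg]⟩

lemma coverGrading_isGraded {G : Type u} [AddCommGroup G]
    (𝓖 : (Fin n → ℤ) → AddSubgroup G) :
    IsGradedModule R (coverGrading (R := R) 𝓖) where
  isInternal := by
    classical
    let w : Fin n → Fin n → ℤ := fun i => Pi.single i 1
    let q : (Fin n → ℤ) → ((Σ b, 𝓖 b) →₀ Poly R n) →+ ((Σ b, 𝓖 b) →₀ Poly R n) := fun a =>
      { toFun := fun f => Finsupp.onFinset f.support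
          (fun s => weightedHomogeneousComponent w (a - s.1) (f s))
          (fun s hs => by
            rw [Finsupp.mem_support_iff]
            intro h0
            exact hs (by rw [h0, map_zero]))
        map_zero' := by ext1 s; simp
        map_add' := fun f g => by ext1 s; simp }
    have hq : ∀ a f s, q a f s = weightedHomogeneousComponent w (a - s.1) (f s) :=
      fun _ _ _ => rfl
    refine isInternal_of_proj _ q ?_ ?_ ?_
    · intro a f hf
      ext1 s
      rw [hq]
      exact IsWeightedHomogeneous.weightedHomogeneousComponent_same (hf s)
    · intro a b hab f hf
      ext1 s
      rw [hq]
      exact IsWeightedHomogeneous.weightedHomogeneousComponent_ne _ (hf s)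
        (fun h => hab (sub_left_injective h).symm)
    · intro f
      induction f using Finsupp.induction_linear with
      | zero => exact zero_mem _
      | add f g hf hg => exact add_mem hf hg
      | single s p =>
        induction p using MvPolynomial.induction_on' with
        | monomial d r =>
          refine ⟨DirectSum.of _ (Finsupp.weight w d + s.1)
            ⟨Finsupp.single s (monomial d r), ?_⟩, by rw [DirectSum.coeAddMonoidHom_of]⟩
          intro t
          by_cases h : s = t
          · subst h
            rw [Finsupp.single_eq_same, add_sub_cancel_right]
            exact isWeightedHomogeneous_monomial w d r rfl
          · rw [Finsupp.single_eq_of_ne (Ne.symm h)]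
            exact zero_mem _
        | add p q hp hq =>
          rw [Finsupp.single_add]
          exact add_mem hp hq
  gradedSMul := ⟨by
    intro a b p f hp hf s
    have h := IsWeightedHomogeneous.mul hp (hf s)
    have e : a + (b - s.1) = (a +ᵥ b) - s.1 := by rw [vadd_eq_add, add_sub_assoc]
    rw [e] at h
    exact h⟩

lemma ker_isGraded {G H : Type u} [AddCommGroup G] [Module (Poly R n) G] [AddCommGroup H]
    [Module (Poly R n) H] {𝓖 : (Fin n → ℤ) → AddSubgroup G} {𝓗 : (Fin n → ℤ) → AddSubgroup H}
    (hG : IsGradedModule R 𝓖) (hH : IsGradedModule R 𝓗) (f : G →ₗ[Poly R n] H)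
    (hf : ∀ a, ∀ x ∈ 𝓖 a, f x ∈ 𝓗 a) :
    IsGradedModule R (M := LinearMap.ker f)
      (fun a => (𝓖 a).comap (LinearMap.ker f).subtype.toAddMonoidHom) where
  isInternal := by
    classical
    let _ := hG.isInternal.chooseDecomposition
    let _ := hH.isInternal.chooseDecomposition
    have hcomp : ∀ x a, f (DirectSum.decompose 𝓖 x a) = DirectSum.decompose 𝓗 (f x) a := by
      intro x a
      induction x using DirectSum.Decomposition.inductionOn 𝓖 with
      | zero => simp
      | @homogeneous i m =>
        by_cases h : i = a
        · subst h
          rw [DirectSum.decompose_of_mem_same 𝓖 m.2,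
            DirectSum.decompose_of_mem_same 𝓗 (hf _ _ m.2)]
        · rw [DirectSum.decompose_of_mem_ne 𝓖 m.2 h,
            DirectSum.decompose_of_mem_ne 𝓗 (hf _ _ m.2) h, map_zero]
      | add x y hx hy => simp [hx, hy]
    let q : (Fin n → ℤ) → LinearMap.ker f →+ LinearMap.ker f := fun a =>
      { toFun := fun x => ⟨DirectSum.decompose 𝓖 (x : G) a, by
          rw [LinearMap.mem_ker, hcomp, LinearMap.mem_ker.1 x.2]; simp⟩
        map_zero' := by ext1; simp
        map_add' := fun x y => by ext1; simp }
    refine isInternal_of_proj _ q ?_ ?_ ?_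
    · intro a x hx
      ext1
      exact DirectSum.decompose_of_mem_same 𝓖 hx
    · intro a b hab x hx
      ext1
      exact DirectSum.decompose_of_mem_ne 𝓖 hx hab
    · intro x
      have hx : x = ∑ a ∈ (DirectSum.decompose 𝓖 (x : G)).support, q a x := by
        ext1
        rw [AddSubmonoidClass.coe_finsetSum]
        exact (DirectSum.sum_support_decompose 𝓖 (x : G)).symm
      rw [hx]
      refine sum_mem fun a _ => ⟨DirectSum.of _ a ⟨q a x, ?_⟩, ?_⟩
      · exact (DirectSum.decompose 𝓖 (x : G) a).2
      · rw [DirectSum.coeAddMonoidHom_of]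
  gradedSMul := ⟨by
    intro a b p x hp hx
    exact hG.gradedSMul.smul_mem hp hx⟩

/-- A bundled graded module. -/
structure Obj (R : Type u) [CommRing R] (n : ℕ) where
  /-- the underlying module -/
  X : ModuleCat.{u} (Poly R n)
  /-- the homogeneous components -/
  grading : (Fin n → ℤ) → AddSubgroup X
  isGraded : IsGradedModule R grading

/-- The free cover of a graded module. -/
def Obj.cover (G : Obj R n) : Obj R n where
  X := ModuleCat.of _ ((Σ b, G.grading b) →₀ Poly R n)
  grading := coverGrading G.grading
  isGraded := coverGrading_isGraded G.grading

/-- The kernel of the free cover of a graded module. -/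
def Obj.syz (G : Obj R n) : Obj R n where
  X := ModuleCat.of _ (LinearMap.ker (coverMap (R := R) G.grading))
  grading a := (coverGrading G.grading a).comap
    (LinearMap.ker (coverMap (R := R) G.grading)).subtype.toAddMonoidHom
  isGraded := ker_isGraded (coverGrading_isGraded G.grading) G.isGraded _
    (coverMap_mem G.isGraded)

/-- The iterated syzygies of a graded module. -/
def Obj.iterSyz (G : Obj R n) : ℕ → Obj R n
  | 0 => G
  | i + 1 => (G.iterSyz i).syz

/-- The augmentation of the free cover. -/
def Obj.aug (G : Obj R n) : G.cover.X ⟶ G.X := ModuleCat.ofHom (coverMap G.grading)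

/-- The inclusion of the syzygies in the free cover. -/
def Obj.incl (G : Obj R n) : G.syz.X ⟶ G.cover.X :=
  ModuleCat.ofHom (LinearMap.ker (coverMap (R := R) G.grading)).subtype

lemma Obj.incl_aug (G : Obj R n) : G.incl ≫ G.aug = 0 := by
  ext x
  exact x.2

/-- The differential, through the syzygies. -/
def Obj.d (G : Obj R n) : G.syz.cover.X ⟶ G.cover.X := G.syz.aug ≫ G.incl

lemma Obj.d_aug (G : Obj R n) : G.d ≫ G.aug = 0 := by
  rw [Obj.d, Category.assoc, G.incl_aug, Limits.comp_zero]

lemma Obj.d_d (G : Obj R n) : G.syz.d ≫ G.d = 0 := by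
  have h := G.syz.d_aug
  rw [Obj.d.eq_1 G, ← Category.assoc, h, Limits.zero_comp]

lemma Obj.exact_aug (G : Obj R n) : (ShortComplex.mk G.d G.aug G.d_aug).Exact := by
  rw [ShortComplex.moduleCat_exact_iff]
  intro x hx
  obtain ⟨y, hy⟩ := coverMap_surjective G.syz.isGraded (⟨x, hx⟩ : LinearMap.ker _)
  exact ⟨y, congrArg Subtype.val hy⟩

lemma Obj.exact_d (G : Obj R n) : (ShortComplex.mk G.syz.d G.d G.d_d).Exact := by
  rw [ShortComplex.moduleCat_exact_iff]
  intro x hx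
  have hx' : G.syz.aug.hom x = 0 := Subtype.ext hx
  exact (ShortComplex.moduleCat_exact_iff _).1 G.syz.exact_aug x hx'

lemma Obj.d_mem (G : Obj R n) (a : Fin n → ℤ) (x : G.syz.cover.X)
    (hx : x ∈ G.syz.cover.grading a) : G.d.hom x ∈ G.cover.grading a :=
  coverMap_mem G.syz.isGraded a x hx

instance (G : Obj R n) : Epi G.aug :=
  (ModuleCat.epi_iff_surjective _).2 (coverMap_surjective G.isGraded)

instance (G : Obj R n) : Mono G.incl :=
  (ModuleCat.mono_iff_injective _).2 Subtype.val_injective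

instance (G : Obj R n) : Projective G.cover.X :=
  (IsProjective.iff_projective _).1
    (inferInstanceAs (Module.Projective (Poly R n) ((Σ b, G.grading b) →₀ Poly R n)))

/-- The complex of iterated free covers. -/
def Obj.complex (G : Obj R n) : ChainComplex (ModuleCat.{u} (Poly R n)) ℕ :=
  ChainComplex.of (fun i => (G.iterSyz i).cover.X) (fun i => (G.iterSyz i).d)
    (fun i => (G.iterSyz i).d_d)

lemma Obj.complex_d (G : Obj R n) (i : ℕ) :
    G.complex.d (i + 1) i = (G.iterSyz i).d :=
  ChainComplex.of_d (fun i => (G.iterSyz i).cover.X) (fun i => (G.iterSyz i).d) i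

lemma Obj.complex_exactAt_succ (G : Obj R n) (i : ℕ) : G.complex.ExactAt (i + 1) := by
  rw [HomologicalComplex.exactAt_iff' _ (i + 1 + 1) (i + 1) i (by simp) (by simp)]
  have h := (G.iterSyz i).exact_d
  convert h using 1
  simp only [HomologicalComplex.sc', HomologicalComplex.shortComplexFunctor', G.complex_d]
  rfl

/-- The augmentation of the complex of iterated free covers. -/
def Obj.complexAug (G : Obj R n) : G.complex.X 0 ⟶ G.X := G.aug

lemma Obj.complex_d_comp_aug (G : Obj R n) : G.complex.d 1 0 ≫ G.complexAug = 0 := by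
  rw [G.complex_d 0]
  exact G.d_aug

lemma Obj.exact_complexAug (G : Obj R n) :
    (ShortComplex.mk (G.complex.d 1 0) G.complexAug G.complex_d_comp_aug).Exact := by
  have h := G.exact_aug
  convert h using 1
  simp only [G.complex_d]
  rfl

instance (G : Obj R n) : Epi G.complexAug := inferInstanceAs (Epi G.aug)

/-- The standard projective resolution of a graded module by free covers. -/
def Obj.projectiveResolution (G : Obj R n) : ProjectiveResolution G.X where
  complex := G.complex
  projective i := inferInstanceAs (Projective (G.iterSyz i).cover.X)
  π := (ChainComplex.toSingle₀Equiv _ _).symm ⟨G.complexAug, G.complex_d_comp_aug⟩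
  quasiIso := ⟨fun i => by
    cases i with
    | zero =>
      rw [ChainComplex.quasiIsoAt₀_iff, ShortComplex.quasiIso_iff_of_zeros']
      · refine (ShortComplex.exact_and_epi_g_iff_of_iso ?_).2
          ⟨G.exact_complexAug, by dsimp; infer_instance⟩
        exact ShortComplex.isoMk (Iso.refl _) (Iso.refl _) (Iso.refl _)
          (by simp; exact (Category.id_comp _).trans (Category.comp_id _).symm)
          (by simp; exact (Category.id_comp _).trans (Category.comp_id _).symm)
      all_goals rfl
    | succ i =>
      rw [quasiIsoAt_iff_exactAt']
      · exact G.complex_exactAt_succ i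
      · apply ChainComplex.exactAt_succ_single_obj⟩

end Existence

/-- The standard graded resolution of a graded module: iterated free covers. -/
def standardResolution {R : Type u} [CommRing R] {n : ℕ} {N : Type u} [AddCommGroup N]
    [Module (Poly R n) N] (𝓝 : (Fin n → ℤ) → AddSubgroup N) (h𝓝 : IsGradedModule R 𝓝) :
    GradedResolution (R := R) 𝓝 where
  res := Obj.projectiveResolution ⟨ModuleCat.of _ N, 𝓝, h𝓝⟩
  grading i := (Obj.iterSyz ⟨ModuleCat.of _ N, 𝓝, h𝓝⟩ i).cover.grading
  isGraded i := (Obj.iterSyz ⟨ModuleCat.of _ N, 𝓝, h𝓝⟩ i).cover.isGraded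
  d_mem i j a x hx := by
    by_cases hij : i = j + 1
    · subst hij
      have h := Obj.complex_d (R := R) ⟨ModuleCat.of _ N, 𝓝, h𝓝⟩ j
      change ((Obj.complex (R := R) ⟨ModuleCat.of _ N, 𝓝, h𝓝⟩).d (j + 1) j).hom x ∈ _
      rw [h]
      exact Obj.d_mem _ a x hx
    · have h : (Obj.complex (R := R) ⟨ModuleCat.of _ N, 𝓝, h𝓝⟩).d i j = 0 :=
        HomologicalComplex.shape _ i j (fun h => hij h.symm)
      change ((Obj.complex (R := R) ⟨ModuleCat.of _ N, 𝓝, h𝓝⟩).d i j).hom x ∈ _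
      rw [h]
      exact zero_mem _
  π_mem a x hx := coverMap_mem h𝓝 a x hx

/-! ### The grading of `Tor` -/

/-- `Tor_i^S(M, N)`, the left derived functor of the tensor product over `S`. -/
abbrev tor (R : Type u) [CommRing R] (n : ℕ) (M N : Type u) [AddCommGroup M]
    [Module (Poly R n) M] [AddCommGroup N] [Module (Poly R n) N] (i : ℕ) :
    ModuleCat.{u} (Poly R n) :=
  ((Tor (ModuleCat.{u} (Poly R n)) i).obj (ModuleCat.of _ M)).obj (ModuleCat.of _ N)

section Grading

variable {R : Type u} [CommRing R] {n : ℕ} {M N : Type u} [AddCommGroup M]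
  [Module (Poly R n) M] [AddCommGroup N] [Module (Poly R n) N]
  (𝓜 : (Fin n → ℤ) → AddSubgroup M) {𝓝 : (Fin n → ℤ) → AddSubgroup N}

/-- The complex `M ⊗_S P` for a resolution `P` of `N`. -/
def GradedResolution.tensorComplex (M : Type u) [AddCommGroup M] [Module (Poly R n) M]
    (P : GradedResolution (R := R) 𝓝) : ChainComplex (ModuleCat.{u} (Poly R n)) ℕ :=
  (((MonoidalCategory.tensoringLeft (ModuleCat.{u} (Poly R n))).obj
    (ModuleCat.of _ M)).mapHomologicalComplex _).obj P.res.complex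

/-- The class in `Tor_i^S(M, N)` of a cycle of `M ⊗_S P`. -/
def GradedResolution.cycleClass (M : Type u) [AddCommGroup M] [Module (Poly R n) M]
    (P : GradedResolution (R := R) 𝓝) (i : ℕ) :
    (P.tensorComplex M).cycles i ⟶ tor R n M N i :=
  (P.tensorComplex M).homologyπ i ≫ (P.res.isoLeftDerivedObj
    ((MonoidalCategory.tensoringLeft (ModuleCat.{u} (Poly R n))).obj (ModuleCat.of _ M)) i).inv

/-- The subgroup of `Tor_i^S(M, N)` of the classes of those cycles of `M ⊗_S P_i` that are
homogeneous of degree `a`, for a graded resolution `P` of `N`. -/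
def GradedResolution.torPart (P : GradedResolution (R := R) 𝓝) (i : ℕ) (a : Fin n → ℤ) :
    AddSubgroup (tor R n M N i) :=
  AddSubgroup.map (P.cycleClass M i).hom.toAddMonoidHom
    (AddSubgroup.comap ((P.tensorComplex M).iCycles i).hom.toAddMonoidHom
      (show AddSubgroup ((P.tensorComplex M).X i) from tensorGrading 𝓜 (P.grading i) a))

/-- `Tor_i^S(M, N)_a`, the component of degree `a` of `Tor_i^S(M, N)` for graded modules `M`, `N`.
It is computed with the standard graded resolution of `N`. -/
def torComponent (h𝓝 : IsGradedModule R 𝓝) (i : ℕ) (a : Fin n → ℤ) :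
    AddSubgroup (tor R n M N i) :=
  (standardResolution 𝓝 h𝓝).torPart 𝓜 i a

end Grading

end ZnGraded

end

noncomputable section

namespace ZnGraded

/-! ### The counting argument -/

section Count

variable {n : ℕ}

/-! Let `P` be the resolution of `N` by graded free modules. Then `M ⊗_S P` is the quotient of `M
⊗_R P` by the images of the operators `θ_k = X_k ⊗ 1 - 1 ⊗ X_k`, each of degree `ε_k`. If `M` or `N`
is flat over `R`, then `M ⊗_R P` is exact in positive degrees and resolves `M ⊗_R N`. Since the
terms of `P` are free, the `θ_k` form a regular sequence in every order. Hence, for a set `B` of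
variables, the complex `C_B = (M ⊗_R P)/(θ_k : k ∈ B)` has the Koszul homology of `M ⊗_R N` with
respect to the `θ_k`, `k ∈ B`, and `B = univ` gives `Tor^S(M, N)`.

For `k ∉ B` the exact sequence `0 → C_B(-ε_k) → C_B → C_{B ∪ k} → 0` has two consequences. Splitting
(`NonzeroAt.split`): a nonzero class of `H_p(C_{B ∪ k})` in degree `a` forces `H_p(C_B)_a ≠ 0` or
`H_{p-1}(C_B)_{a - ε_k} ≠ 0`. Descent (`NonzeroAt.descend`): if `H_i(C_B)_b ≠ 0`, then `H_i(C_{B ∪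
k})` is nonzero in some degree `b - t ε_k`, `t ≥ 0`. Otherwise nonzero classes could be divided by
`θ_k` forever, against boundedness below; this is Nakayama's lemma.

The count (`exists_finset_of_koszul`) uses only these two facts and the vanishing of `H_i(C_B)` for
`i > |B|`. In the case where splitting at `k` lowers the homological degree, one family of degrees
has `k`-th coordinate at most `a_k - 1` and a second one has it equal to `a_k`. They are disjoint,
and their sizes add up by Pascal's rule.

Over a field flatness is automatic, and nonzero elements in distinct degrees of `Tor` are linearly
independent, so the number of degrees bounds the dimension. -/

lemma total_sub_single (a : Fin n → ℤ) (k : Fin n) (t : ℤ) :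
    total (a - Pi.single k t) = total a - t := by
  simp [total, Finset.sum_sub_distrib]

/-- Moving the members of a finite set, all with the same `k`-th coordinate, in direction `-ε_k`
does not identify any of them. -/
lemma exists_lowered (P Q : (Fin n → ℤ) → Prop) (k : Fin n) (e : ℤ) (T : Finset (Fin n → ℤ))
    (hT : ∀ b ∈ T, b k = e ∧ P b)
    (hdesc : ∀ b, P b → ∃ t : ℕ, Q (b - Pi.single k (t : ℤ))) :
    ∃ T' : Finset (Fin n → ℤ), T'.card = T.card ∧
      ∀ b' ∈ T', Q b' ∧ ∃ b ∈ T, ∃ t : ℕ, b' = b - Pi.single k (t : ℤ) := by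
  classical
  have H : ∀ b, ∃ t : ℕ, b ∈ T → Q (b - Pi.single k (t : ℤ)) := by
    intro b
    by_cases hb : b ∈ T
    · obtain ⟨t, ht⟩ := hdesc b (hT b hb).2
      exact ⟨t, fun _ => ht⟩
    · exact ⟨0, fun h => absurd h hb⟩
  choose t ht using H
  refine ⟨T.image fun b => b - Pi.single k (t b : ℤ), ?_, ?_⟩
  · refine Finset.card_image_of_injOn fun b hb c hc hbc => ?_
    funext j
    by_cases hj : j = k
    · subst hj
      rw [(hT b hb).1, (hT c hc).1]
    · have := congrFun hbc j
      simpa [hj] using this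
  · intro b' hb'
    obtain ⟨b, hb, rfl⟩ := Finset.mem_image.1 hb'
    exact ⟨ht b hb, b, hb, t b, rfl⟩

lemma sub_single_le (b : Fin n → ℤ) (k : Fin n) (t : ℕ) : b - Pi.single k (t : ℤ) ≤ b := by
  intro j
  by_cases hj : j = k
  · subst hj; simp
  · simp [hj]

/-- The counting argument. Think of `h B i a` as the nonvanishing in degree `a` of the `i`-th
Koszul homology of the variables in `B`; those in `D` are not to be split off. -/
theorem exists_finset_of_koszul (h : Finset (Fin n) → ℕ → (Fin n → ℤ) → Prop)
    (hsplit : ∀ B k, k ∉ B → ∀ p a, h (insert k B) p a →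
      h B p a ∨ ∃ q, p = q + 1 ∧ h B q (a - Pi.single k 1))
    (hdesc : ∀ B k, k ∉ B → ∀ i b, h B i b → ∃ t : ℕ, h (insert k B) i (b - Pi.single k (t : ℤ)))
    (hdim : ∀ B i b, h B i b → i ≤ B.card) (U : Finset (Fin n)) :
    ∀ (D : Finset (Fin n)), Disjoint U D → ∀ (p : ℕ) (a : Fin n → ℤ), h (U ∪ D) p a →
      ∀ i, D.card ≤ i → i ≤ p → ∃ T : Finset (Fin n → ℤ),
        (p - D.card).choose (i - D.card) ≤ T.card ∧
        ∀ b ∈ T, (∀ k, k ∉ U → b k = a k) ∧ b ≤ a ∧ total b ≤ total a - p + i ∧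
          h (U ∪ D) i b := by
  classical
  -- The set `D` records frozen coordinates: the degrees found agree with `a` outside `U`, in
  -- particular on `D`. Freezing one more coordinate lowers both entries of the binomial coefficient
  -- by one.
  induction U using Finset.induction_on with
  | empty =>
    intro D _ p a hp i hDi hip
    rw [Finset.empty_union] at hp ⊢
    -- With nothing left to split, `p ≤ |D| ≤ i` by the vanishing above the number of variables.
    obtain rfl : i = p := le_antisymm hip ((hdim _ _ _ hp).trans hDi)
    refine ⟨{a}, by simp, ?_⟩
    intro b hb
    rw [Finset.mem_singleton] at hb
    subst hb
    exact ⟨fun _ _ => rfl, le_rfl, by simp, hp⟩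
  | insert k U hkU ih =>
    intro D hUD p a hp i hDi hip
    rw [Finset.disjoint_insert_left] at hUD
    obtain ⟨hkD, hUD⟩ := hUD
    have hk : k ∉ U ∪ D := by simp [hkU, hkD]
    rw [Finset.insert_union] at hp ⊢
    rcases hip.eq_or_lt with rfl | hip
    · refine ⟨{a}, by simp, ?_⟩
      intro b hb
      rw [Finset.mem_singleton] at hb
      subst hb
      exact ⟨fun _ _ => rfl, le_rfl, by simp, hp⟩
    -- Descent along `k` of a family obtained for `U ∪ D`. Its members share the `k`-th coordinate
    -- `a' k` because `k ∉ U`, so they stay distinct, and they end with `k`-th coordinate at most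
    -- `a' k`.
    have lower : ∀ (a' : Fin n → ℤ) (q : ℕ), a' ≤ a → (∀ j, j ≠ k → a' j = a j) →
        total a' - q ≤ total a - p →
        (∃ T : Finset (Fin n → ℤ), (q - D.card).choose (i - D.card) ≤ T.card ∧
          ∀ b ∈ T, (∀ j, j ∉ U → b j = a' j) ∧ b ≤ a' ∧ total b ≤ total a' - q + i ∧
            h (U ∪ D) i b) →
        ∃ T : Finset (Fin n → ℤ), (q - D.card).choose (i - D.card) ≤ T.card ∧
          ∀ b ∈ T, ((∀ j, j ∉ insert k U → b j = a j) ∧ b ≤ a ∧ total b ≤ total a - p + i ∧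
            h (insert k (U ∪ D)) i b) ∧ b k ≤ a' k := by
      rintro a' q ha' haj htot ⟨T, hT, hT'⟩
      obtain ⟨T', hc, hT''⟩ := exists_lowered (h (U ∪ D) i) (h (insert k (U ∪ D)) i) k (a' k) T
        (fun b hb => ⟨(hT' b hb).1 k hkU, (hT' b hb).2.2.2⟩) (hdesc _ k hk i)
      refine ⟨T', hc ▸ hT, ?_⟩
      intro b' hb'
      obtain ⟨hQ, b, hb, t, rfl⟩ := hT'' b' hb'
      obtain ⟨h1, h2, h3, -⟩ := hT' b hb
      have hle := sub_single_le b k t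
      refine ⟨⟨?_, hle.trans (h2.trans ha'), ?_, hQ⟩, (hle k).trans (h2 k)⟩
      · intro j hj
        rw [Finset.mem_insert, not_or] at hj
        rw [Pi.sub_apply, Pi.single_eq_of_ne hj.1, sub_zero, h1 j hj.2, haj j hj.1]
      · rw [total_sub_single]
        have : (0 : ℤ) ≤ t := Int.natCast_nonneg t
        linarith
    rcases hsplit _ k hk p a hp with hA | ⟨q, rfl, hB⟩
    · obtain ⟨T, hT, hT'⟩ := lower a p le_rfl (fun _ _ => rfl) le_rfl
        (ih D hUD p a hA i hDi hip.le)
      exact ⟨T, hT, fun b hb => (hT' b hb).1⟩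
    · obtain ⟨T, hT, hT'⟩ := lower (a - Pi.single k 1) q (sub_single_le a k 1)
        (fun j hj => by simp [hj]) (by rw [total_sub_single]; push_cast; linarith)
        (ih D hUD q _ hB i hDi (Nat.lt_succ_iff.1 hip))
      -- If `i = |D|` the required number is `1` and the first family suffices; `k` could not be
      -- frozen here, as that needs `|D| + 1 ≤ i`.
      rcases hDi.eq_or_lt with hDi | hDi
      · refine ⟨T, ?_, fun b hb => (hT' b hb).1⟩
        rw [hDi, Nat.sub_self, Nat.choose_zero_right] at hT ⊢
        exact hT
      · have hcard : (insert k D).card = D.card + 1 := Finset.card_insert_of_notMem hkD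
        have hun : U ∪ insert k D = insert k (U ∪ D) := by
          rw [Finset.union_insert]
        -- The second family starts from the original class, with `k` frozen instead of split off.
        -- Its members have `k`-th coordinate exactly `a k`, those of `T` at most `a k - 1`.
        obtain ⟨T₂, hT₂, hT₂'⟩ := ih (insert k D)
          (by rw [Finset.disjoint_insert_right]; exact ⟨hkU, hUD⟩) (q + 1) a (by rwa [hun]) i
          (by omega) hip.le
        refine ⟨T ∪ T₂, ?_, ?_⟩
        · rw [Finset.card_union_of_disjoint]
          · rw [hcard] at hT₂
            have e1 : q + 1 - D.card = (q - D.card) + 1 := by omega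
            have e2 : i - D.card = (i - (D.card + 1)) + 1 := by omega
            have e3 : q + 1 - (D.card + 1) = q - D.card := by omega
            rw [e3] at hT₂
            rw [e2] at hT
            rw [e1, e2, Nat.choose_succ_succ', add_comm]
            exact Nat.add_le_add hT hT₂
          · rw [Finset.disjoint_left]
            intro b hb hb2
            have h1 := (hT' b hb).2
            have h2 := (hT₂' b hb2).1 k hkU
            simp at h1
            omega
        · intro b hb
          rcases Finset.mem_union.1 hb with hb | hb
          · exact (hT' b hb).1
          · obtain ⟨h1, h2, h3, h4⟩ := hT₂' b hb
            rw [hun] at h4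
            exact ⟨fun j hj => h1 j fun hjU => hj (Finset.mem_insert_of_mem hjU), h2, h3, h4⟩

end Count

end ZnGraded

namespace ZnGraded

/-! ### Graded complexes with a regular family of operators -/

/-- A chain complex of `ℤ^n`-graded abelian groups, given by its degree projections `proj`, with
commuting operators `θ k` of degree `ε_k` which form a regular sequence in every order, and whose
homology is concentrated in homological degree `0` and bounded below. -/
structure RegularComplex (n : ℕ) where
  /-- the terms -/
  E : ℕ → Type u
  [grp : ∀ i, AddCommGroup (E i)]
  /-- the differentials -/
  d : ∀ i, E (i + 1) →+ E i
  /-- the operators -/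
  θ : Fin n → ∀ i, E i →+ E i
  /-- the degree projections -/
  proj : (Fin n → ℤ) → ∀ i, E i →+ E i
  proj_proj : ∀ a i x, proj a i (proj a i x) = proj a i x
  d_θ : ∀ k i x, d i (θ k (i + 1) x) = θ k i (d i x)
  θ_θ : ∀ k l i x, θ k i (θ l i x) = θ l i (θ k i x)
  proj_d : ∀ a i x, proj a i (d i x) = d i (proj a (i + 1) x)
  proj_θ : ∀ a k i x, proj a i (θ k i x) = θ k i (proj (a - Pi.single k 1) i x)
  regular : ∀ (B : Finset (Fin n)) (k : Fin n), k ∉ B → ∀ i x,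
    θ k i x ∈ B.sup (fun l => (θ l i).range) → x ∈ B.sup (fun l => (θ l i).range)
  exact : ∀ i x, d i x = 0 → ∃ y, d (i + 1) y = x
  d_d : ∀ i x, d i (d (i + 1) x) = 0
  bounded : ∃ c : ℤ, ∀ a, total a ≤ c → ∀ x, proj a 0 x = x → ∃ y, d 0 y = x

namespace RegularComplex

attribute [instance] RegularComplex.grp

variable {n : ℕ} (C : RegularComplex.{u} n)

/-- The subgroup generated by the images of the operators `θ k` with `k ∈ B`. -/
def I (B : Finset (Fin n)) (i : ℕ) : AddSubgroup (C.E i) := B.sup fun k => (C.θ k i).range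

/-! ### Stability of the subgroups generated by the operators -/

lemma I_empty (i : ℕ) : C.I ∅ i = ⊥ := Finset.sup_empty

lemma mem_I_insert {B : Finset (Fin n)} {k : Fin n} {i : ℕ} {x : C.E i} :
    x ∈ C.I (insert k B) i ↔ ∃ y, ∃ u ∈ C.I B i, C.θ k i y + u = x := by
  rw [I, Finset.sup_insert, AddSubgroup.mem_sup]
  constructor
  · rintro ⟨_, ⟨y, rfl⟩, u, hu, rfl⟩
    exact ⟨y, u, hu, rfl⟩
  · rintro ⟨y, u, hu, rfl⟩
    exact ⟨_, ⟨y, rfl⟩, u, hu, rfl⟩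

lemma I_insert_of_mem {B : Finset (Fin n)} {k : Fin n} {i : ℕ} {x : C.E i} (hx : x ∈ C.I B i) :
    x ∈ C.I (insert k B) i :=
  C.mem_I_insert.2 ⟨0, x, hx, by simp⟩

lemma θ_mem_I_insert {B : Finset (Fin n)} {k : Fin n} {i : ℕ} (x : C.E i) :
    C.θ k i x ∈ C.I (insert k B) i :=
  C.mem_I_insert.2 ⟨x, 0, zero_mem _, by simp⟩

lemma θ_mem_I (B : Finset (Fin n)) (k : Fin n) (i : ℕ) :
    ∀ x ∈ C.I B i, C.θ k i x ∈ C.I B i := by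
  classical
  induction B using Finset.induction_on with
  | empty => intro x hx; rw [I_empty, AddSubgroup.mem_bot] at *; simp [hx]
  | insert l B _ ih =>
    intro x hx
    obtain ⟨y, u, hu, rfl⟩ := C.mem_I_insert.1 hx
    rw [map_add, C.θ_θ]
    exact add_mem (C.θ_mem_I_insert _) (C.I_insert_of_mem (ih u hu))

lemma d_mem_I (B : Finset (Fin n)) (i : ℕ) : ∀ x ∈ C.I B (i + 1), C.d i x ∈ C.I B i := by
  classical
  induction B using Finset.induction_on with
  | empty => intro x hx; rw [I_empty, AddSubgroup.mem_bot] at *; simp [hx]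
  | insert l B _ ih =>
    intro x hx
    obtain ⟨y, u, hu, rfl⟩ := C.mem_I_insert.1 hx
    rw [map_add, C.d_θ]
    exact add_mem (C.θ_mem_I_insert _) (C.I_insert_of_mem (ih u hu))

lemma proj_mem_I (B : Finset (Fin n)) (a : Fin n → ℤ) (i : ℕ) :
    ∀ x ∈ C.I B i, C.proj a i x ∈ C.I B i := by
  classical
  induction B using Finset.induction_on with
  | empty => intro x hx; rw [I_empty, AddSubgroup.mem_bot] at *; simp [hx]
  | insert l B _ ih =>
    intro x hx
    obtain ⟨y, u, hu, rfl⟩ := C.mem_I_insert.1 hx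
    rw [map_add, C.proj_θ]
    exact add_mem (C.θ_mem_I_insert _) (C.I_insert_of_mem (ih u hu))

/-- `x` is a cycle modulo the operators in `B`. -/
def IsCycle (B : Finset (Fin n)) : ∀ i, C.E i → Prop
  | 0, _ => True
  | i + 1, x => C.d i x ∈ C.I B i

/-- `x` is a boundary modulo the operators in `B`. -/
def IsBoundary (B : Finset (Fin n)) (i : ℕ) (x : C.E i) : Prop :=
  ∃ w, ∃ v ∈ C.I B i, C.d i w + v = x

/-- The homology modulo the operators in `B` is nonzero in degree `a`. -/
def NonzeroAt (B : Finset (Fin n)) (i : ℕ) (a : Fin n → ℤ) : Prop :=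
  ∃ x : C.E i, C.proj a i x = x ∧ C.IsCycle B i x ∧ ¬ C.IsBoundary B i x

/-! ### Homology modulo a set of operators: splitting and descent -/

variable {C}

lemma IsBoundary.add {B : Finset (Fin n)} {i : ℕ} {x y : C.E i} (hx : C.IsBoundary B i x)
    (hy : C.IsBoundary B i y) : C.IsBoundary B i (x + y) := by
  obtain ⟨w, v, hv, rfl⟩ := hx
  obtain ⟨w', v', hv', rfl⟩ := hy
  exact ⟨w + w', v + v', add_mem hv hv', by rw [map_add]; abel⟩

lemma IsBoundary.of_mem {B : Finset (Fin n)} {i : ℕ} {x : C.E i} (hx : x ∈ C.I B i) :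
    C.IsBoundary B i x := ⟨0, x, hx, by simp⟩

lemma IsBoundary.d (B : Finset (Fin n)) {i : ℕ} (x : C.E (i + 1)) :
    C.IsBoundary B i (C.d i x) := ⟨x, 0, zero_mem _, by simp⟩

lemma IsBoundary.θ {B : Finset (Fin n)} {i : ℕ} {x : C.E i} (hx : C.IsBoundary B i x)
    (k : Fin n) : C.IsBoundary B i (C.θ k i x) := by
  obtain ⟨w, v, hv, rfl⟩ := hx
  rw [map_add, ← C.d_θ]
  exact (IsBoundary.d B _).add (IsBoundary.of_mem (C.θ_mem_I B k i v hv))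

lemma IsBoundary.proj {B : Finset (Fin n)} {i : ℕ} {x : C.E i} (hx : C.IsBoundary B i x)
    (a : Fin n → ℤ) : C.IsBoundary B i (C.proj a i x) := by
  obtain ⟨w, v, hv, rfl⟩ := hx
  rw [map_add, C.proj_d]
  exact (IsBoundary.d B _).add (IsBoundary.of_mem (C.proj_mem_I B a i v hv))

lemma IsBoundary.insert {B : Finset (Fin n)} {i : ℕ} {x : C.E i} (hx : C.IsBoundary B i x)
    (k : Fin n) : C.IsBoundary (insert k B) i x := by
  obtain ⟨w, v, hv, rfl⟩ := hx
  exact ⟨w, v, C.I_insert_of_mem hv, rfl⟩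

lemma IsCycle.insert {B : Finset (Fin n)} {i : ℕ} {x : C.E i} (hx : C.IsCycle B i x)
    (k : Fin n) : C.IsCycle (insert k B) i x := by
  cases i with
  | zero => trivial
  | succ i => exact C.I_insert_of_mem hx

/-- This is exactness at the middle of `H_p(C_B) → H_p(C_{B ∪ k}) → H_{p-1}(C_B)(-ε_k)`, done on
elements. Writing `d x = θ_k y + u` with `u ∈ I_B`, the class of `y` is the image of `x` under the
connecting map. If `y = d w + v` is a boundary modulo `B`, then `x - θ_k w` is a cycle modulo `B`
that represents the class of `x`. -/
lemma NonzeroAt.split {B : Finset (Fin n)} {k : Fin n} (hk : k ∉ B) {p : ℕ} {a : Fin n → ℤ}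
    (h : C.NonzeroAt (insert k B) p a) :
    C.NonzeroAt B p a ∨ ∃ q, p = q + 1 ∧ C.NonzeroAt B q (a - Pi.single k 1) := by
  obtain ⟨x, hxa, hcyc, hbd⟩ := h
  cases p with
  | zero => exact Or.inl ⟨x, hxa, trivial, fun hb => hbd (hb.insert k)⟩
  | succ q =>
    obtain ⟨y₀, u₀, hu₀, hyu₀⟩ := C.mem_I_insert.1 hcyc
    obtain ⟨y, hy, u, hu, hyu⟩ : ∃ y, C.proj (a - Pi.single k 1) q y = y ∧ ∃ u ∈ C.I B q,
        C.θ k q y + u = C.d q x := by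
      refine ⟨C.proj (a - Pi.single k 1) q y₀, C.proj_proj _ _ _, C.proj a q u₀,
        C.proj_mem_I B a q _ hu₀, ?_⟩
      rw [← C.proj_θ, ← map_add, hyu₀, C.proj_d, hxa]
    by_cases hyb : C.IsBoundary B q y
    · left
      obtain ⟨w₀, v₀, hv₀, hwv₀⟩ := hyb
      set w := C.proj (a - Pi.single k 1) (q + 1) w₀ with hw
      set v := C.proj (a - Pi.single k 1) q v₀ with hv'
      have hv : v ∈ C.I B q := C.proj_mem_I B _ q _ hv₀
      have hwv : C.d q w + v = y := by
        rw [hw, hv', ← C.proj_d, ← map_add, hwv₀, hy]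
      refine ⟨x - C.θ k (q + 1) w, ?_, ?_, ?_⟩
      · rw [map_sub, hxa, C.proj_θ, hw, C.proj_proj]
      · change C.d q (x - C.θ k (q + 1) w) ∈ C.I B q
        rw [map_sub, C.d_θ, ← hyu, ← hwv, map_add]
        have := add_mem (C.θ_mem_I B k q v hv) hu
        convert this using 1
        abel
      · intro hb
        refine hbd ?_
        have := (hb.insert k).add
          (IsBoundary.of_mem (C.θ_mem_I_insert (B := B) (k := k) w))
        rwa [sub_add_cancel] at this
    · refine Or.inr ⟨q, rfl, y, hy, ?_, hyb⟩
      cases q with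
      | zero => trivial
      | succ q =>
        -- From `d (d x) = 0` follows `θ_k (d y) = -d u ∈ I_B`, and regularity cancels `θ_k`; so `y`
        -- is a cycle modulo `B`.
        refine C.regular B k hk q _ ?_
        change C.θ k q (C.d q y) ∈ C.I B q
        have h0 : C.θ k q (C.d q y) = - C.d q u := by
          rw [← C.d_θ, eq_neg_iff_add_eq_zero, ← map_add, hyu, C.d_d]
        rw [h0]
        exact neg_mem (C.d_mem_I B q u hu)

/-- For `B = ∅` this is exactness in positive degrees, and each splitting raises the homological
degree by at most one. -/
lemma NonzeroAt.le_card {B : Finset (Fin n)} {i : ℕ} {a : Fin n → ℤ} (h : C.NonzeroAt B i a) :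
    i ≤ B.card := by
  classical
  induction B using Finset.induction_on generalizing i a with
  | empty =>
    cases i with
    | zero => simp
    | succ i =>
      obtain ⟨x, -, hcyc, hbd⟩ := h
      refine absurd ?_ hbd
      have h0 : C.d i x = 0 := by
        have : C.d i x ∈ C.I ∅ i := hcyc
        rwa [I_empty, AddSubgroup.mem_bot] at this
      obtain ⟨y, hy⟩ := C.exact i x h0
      exact ⟨y, 0, zero_mem _, by rw [hy, add_zero]⟩
  | insert k B hk ih =>
    rw [Finset.card_insert_of_notMem hk]
    rcases h.split hk with h' | ⟨q, rfl, h'⟩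
    · exact (ih h').trans (Nat.le_succ _)
    · exact Nat.succ_le_succ (ih h')

-- The bound for `H_0(C_∅)` serves for all `B` and `i`: splitting replaces `a` by `a` or `a - ε_k`,
-- and `|a - ε_k| > c` gives `|a| > c`.
variable (C) in
lemma exists_bound : ∃ c : ℤ, ∀ (B : Finset (Fin n)) (i : ℕ) (a : Fin n → ℤ),
    C.NonzeroAt B i a → c < total a := by
  classical
  obtain ⟨c, hc⟩ := C.bounded
  refine ⟨c, fun B => ?_⟩
  induction B using Finset.induction_on with
  | empty =>
    intro i a h
    obtain rfl : i = 0 := by simpa using h.le_card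
    obtain ⟨x, hx, -, hbd⟩ := h
    by_contra hlt
    obtain ⟨y, hy⟩ := hc a (not_lt.1 hlt) x hx
    exact hbd ⟨y, 0, zero_mem _, by rw [hy, add_zero]⟩
  | insert k B hk ih =>
    intro i a h
    rcases h.split hk with h' | ⟨q, rfl, h'⟩
    · exact ih i a h'
    · have := ih q _ h'
      rw [total_sub_single] at this
      linarith

/-- This is exactness of `H_i(C_B)(-ε_k) → H_i(C_B) → H_i(C_{B ∪ k})`. A class that dies modulo
`θ_k` has the form `θ_k [y]`; here `y` is a cycle modulo `B` by regularity, and `[y] ≠ 0` since `θ_k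
[y] ≠ 0`. -/
lemma NonzeroAt.insert_or {B : Finset (Fin n)} {k : Fin n} (hk : k ∉ B) {i : ℕ}
    {b : Fin n → ℤ} (h : C.NonzeroAt B i b) :
    C.NonzeroAt (insert k B) i b ∨ C.NonzeroAt B i (b - Pi.single k 1) := by
  obtain ⟨x, hxb, hcyc, hbd⟩ := h
  by_cases hx : C.IsBoundary (insert k B) i x
  · right
    obtain ⟨w, v, hv, hwv⟩ := hx
    obtain ⟨y₀, u₀, hu₀, rfl⟩ := C.mem_I_insert.1 hv
    set y := C.proj (b - Pi.single k 1) i y₀ with hy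
    set u := C.proj b i u₀ with hu'
    have hu : u ∈ C.I B i := C.proj_mem_I B b i _ hu₀
    have hxe : C.d i (C.proj b (i + 1) w) + (C.θ k i y + u) = x := by
      rw [← hxb, ← hwv, map_add, map_add, C.proj_d, C.proj_θ]
    refine ⟨y, C.proj_proj _ _ _, ?_, ?_⟩
    · cases i with
      | zero => trivial
      | succ i =>
        refine C.regular B k hk i _ ?_
        change C.θ k i (C.d i y) ∈ C.I B i
        have h0 : C.θ k i (C.d i y) = C.d i x - C.d i u := by
          rw [← hxe, map_add, map_add, C.d_d, C.d_θ]
          abel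
        rw [h0]
        exact sub_mem hcyc (C.d_mem_I B i u hu)
    · intro hyb
      exact hbd (hxe ▸ (IsBoundary.d B _).add ((hyb.θ k).add (IsBoundary.of_mem hu)))
  · exact Or.inl ⟨x, hxb, hcyc.insert k, hx⟩

lemma NonzeroAt.descend {B : Finset (Fin n)} {k : Fin n} (hk : k ∉ B) {i : ℕ}
    {b : Fin n → ℤ} (h : C.NonzeroAt B i b) :
    ∃ t : ℕ, C.NonzeroAt (insert k B) i (b - Pi.single k (t : ℤ)) := by
  by_contra! hne
  have key : ∀ t : ℕ, C.NonzeroAt B i (b - Pi.single k (t : ℤ)) := by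
    intro t
    induction t with
    | zero => simpa using h
    | succ t ih =>
      have := (ih.insert_or hk).resolve_left (hne t)
      convert this using 1
      rw [sub_sub, ← Pi.single_add]
      push_cast
      rfl
  obtain ⟨c, hc⟩ := exists_bound C
  -- After `|b| - c` steps the total degree is at most `c`, where all homology vanishes.
  have := hc B i _ (key (total b - c).toNat)
  rw [total_sub_single] at this
  have h2 := Int.self_le_toNat (total b - c)
  linarith

theorem NonzeroAt.exists_finset {p : ℕ} {a : Fin n → ℤ} (h : C.NonzeroAt Finset.univ p a) {i : ℕ}
    (hi : i ≤ p) : ∃ T : Finset (Fin n → ℤ), p.choose i ≤ T.card ∧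
      ∀ b ∈ T, b ≤ a ∧ total b ≤ total a - p + i ∧ C.NonzeroAt Finset.univ i b := by
  obtain ⟨T, hT, hT'⟩ := exists_finset_of_koszul C.NonzeroAt
    (fun _ _ hk _ _ h => h.split hk) (fun _ _ hk _ _ h => h.descend hk)
    (fun _ _ _ h => h.le_card) Finset.univ ∅ (Finset.disjoint_empty_right _) p a
    (by simpa using h) i (Nat.zero_le _) hi
  refine ⟨T, by simpa using hT, fun b hb => ?_⟩
  obtain ⟨-, h2, h3, h4⟩ := hT' b hb
  exact ⟨h2, h3, by simpa using h4⟩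

end RegularComplex

end ZnGraded

namespace ZnGraded

/-! ### Degree projections -/

section Projections

variable {R : Type u} [CommRing R] {n : ℕ}

lemma C_mem_polyGrading (r : R) : (C r : Poly R n) ∈ polyGrading R n 0 :=
  isWeightedHomogeneous_C _ r

lemma X_mem_polyGrading (k : Fin n) :
    (X k : Poly R n) ∈ polyGrading R n (Pi.single k 1) :=
  isWeightedHomogeneous_X R _ k

namespace IsGradedModule

variable {M P : Type u} [AddCommGroup M] [Module (Poly R n) M] [AddCommGroup P]
  [Module (Poly R n) P] {𝓜 : (Fin n → ℤ) → AddSubgroup M} {𝓟 : (Fin n → ℤ) → AddSubgroup P}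

lemma induction (h : IsGradedModule R 𝓜) {p : M → Prop} (zero : p 0)
    (add : ∀ x y, p x → p y → p (x + y)) (homogeneous : ∀ a, ∀ x ∈ 𝓜 a, p x) (x : M) : p x := by
  obtain ⟨g, rfl⟩ := h.isInternal.2 x
  induction g using DirectSum.induction_on with
  | zero => simpa using zero
  | of a x => simpa using homogeneous a x x.2
  | add x y hx hy => rw [map_add]; exact add _ _ hx hy

/-- The decomposition of a graded module. -/
def equiv (h : IsGradedModule R 𝓜) : (DirectSum (Fin n → ℤ) fun a => 𝓜 a) ≃+ M :=
  AddEquiv.ofBijective (DirectSum.coeAddMonoidHom 𝓜) h.isInternal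

lemma equiv_symm_of_mem (h : IsGradedModule R 𝓜) {a : Fin n → ℤ} {x : M} (hx : x ∈ 𝓜 a) :
    h.equiv.symm x = DirectSum.of (fun a => 𝓜 a) a ⟨x, hx⟩ := by
  rw [AddEquiv.symm_apply_eq]
  exact (DirectSum.coeAddMonoidHom_of 𝓜 a ⟨x, hx⟩).symm

/-- The projection of a graded module to its component of degree `a`. -/
def proj (h : IsGradedModule R 𝓜) (a : Fin n → ℤ) : M →+ M :=
  (𝓜 a).subtype.comp ((DFinsupp.evalAddMonoidHom a).comp h.equiv.symm.toAddMonoidHom)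

lemma proj_same (h : IsGradedModule R 𝓜) {a : Fin n → ℤ} {x : M} (hx : x ∈ 𝓜 a) :
    h.proj a x = x := by
  change ((h.equiv.symm x) a : M) = x
  rw [h.equiv_symm_of_mem hx, DirectSum.of_eq_same]

lemma proj_ne (h : IsGradedModule R 𝓜) {a b : Fin n → ℤ} {x : M} (hx : x ∈ 𝓜 a) (hab : a ≠ b) :
    h.proj b x = 0 := by
  change ((h.equiv.symm x) b : M) = 0
  rw [h.equiv_symm_of_mem hx, DirectSum.of_eq_of_ne _ _ _ hab.symm]
  rfl

lemma proj_smul (h : IsGradedModule R 𝓜) {b : Fin n → ℤ} {f : Poly R n}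
    (hf : f ∈ polyGrading R n b) (a : Fin n → ℤ) (x : M) :
    h.proj a (f • x) = f • h.proj (a - b) x := by
  induction x using h.induction with
  | zero => simp
  | add x y hx hy => simp [hx, hy]
  | homogeneous c x hx =>
    have hfx := smul_mem_of_eq h rfl hf hx
    by_cases hc : b + c = a
    · rw [h.proj_same (hc ▸ hfx), h.proj_same (a := a - b)]
      rwa [← hc, add_sub_cancel_left]
    · rw [h.proj_ne hfx hc, h.proj_ne hx, smul_zero]
      rintro rfl
      exact hc (add_sub_cancel b a)

lemma proj_map (h : IsGradedModule R 𝓜) (h' : IsGradedModule R 𝓟) {f : M →+ P}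
    (hf : ∀ a, ∀ x ∈ 𝓜 a, f x ∈ 𝓟 a) (a : Fin n → ℤ) (x : M) :
    h'.proj a (f x) = f (h.proj a x) := by
  induction x using h.induction with
  | zero => simp
  | add x y hx hy => simp [hx, hy]
  | homogeneous c x hx =>
    by_cases hc : c = a
    · subst hc
      rw [h.proj_same hx, h'.proj_same (hf _ _ hx)]
    · rw [h.proj_ne hx hc, h'.proj_ne (hf _ _ hx) hc, map_zero]

/-! ### Degree projections of `M ⊗_R P` -/

variable [Module R M] [Module R P]

lemma tensor_induction (h : IsGradedModule R 𝓜) (h' : IsGradedModule R 𝓟)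
    {q : M ⊗[R] P → Prop} (zero : q 0) (add : ∀ x y, q x → q y → q (x + y))
    (homogeneous : ∀ b c, ∀ m ∈ 𝓜 b, ∀ p ∈ 𝓟 c, q (m ⊗ₜ[R] p)) (x : M ⊗[R] P) : q x := by
  induction x using TensorProduct.induction_on with
  | zero => exact zero
  | add x y hx hy => exact add _ _ hx hy
  | tmul m p =>
    induction m using h.induction with
    | zero => simpa using zero
    | add x y hx hy => rw [TensorProduct.add_tmul]; exact add _ _ hx hy
    | homogeneous b m hm =>
      induction p using h'.induction with
      | zero => simpa using zero
      | add x y hx hy => rw [TensorProduct.tmul_add]; exact add _ _ hx hy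
      | homogeneous c p hp => exact homogeneous b c m hm p hp

/-- The biadditive map inducing the degree projections of `M ⊗_R P`. -/
def tensorProjAux (h : IsGradedModule R 𝓜) (h' : IsGradedModule R 𝓟) (a : Fin n → ℤ) :
    M →+ P →+ M ⊗[R] P :=
  (DirectSum.toAddMonoid fun b : Fin n → ℤ =>
    AddMonoidHom.mk' (fun m : 𝓜 b =>
      (TensorProduct.mk R M P (m : M)).toAddMonoidHom.comp (h'.proj (a - b)))
      (by
        intro m m'
        ext p
        simp)).comp h.equiv.symm.toAddMonoidHom

lemma tensorProjAux_apply (h : IsGradedModule R 𝓜) (h' : IsGradedModule R 𝓟) (a : Fin n → ℤ)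
    {b : Fin n → ℤ} {m : M} (hm : m ∈ 𝓜 b) (p : P) :
    h.tensorProjAux h' a m p = m ⊗ₜ[R] h'.proj (a - b) p := by
  rw [tensorProjAux, AddMonoidHom.comp_apply]
  change (DirectSum.toAddMonoid _ (h.equiv.symm m) : P →+ M ⊗[R] P) p = _
  rw [h.equiv_symm_of_mem hm, DirectSum.toAddMonoid_of]
  rfl

variable [IsScalarTower R (Poly R n) M] [IsScalarTower R (Poly R n) P]

lemma smul_eq_C_smul (r : R) (x : M) : r • x = (C r : Poly R n) • x := by
  rw [← MvPolynomial.algebraMap_eq, algebraMap_smul]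

lemma base_smul_mem (h : IsGradedModule R 𝓜) (r : R) {a : Fin n → ℤ} {x : M} (hx : x ∈ 𝓜 a) :
    r • x ∈ 𝓜 a := by
  rw [smul_eq_C_smul (n := n)]
  exact smul_mem_of_eq h (zero_add a) (C_mem_polyGrading r) hx

lemma proj_base_smul (h : IsGradedModule R 𝓜) (r : R) (a : Fin n → ℤ) (x : M) :
    h.proj a (r • x) = r • h.proj a x := by
  rw [smul_eq_C_smul (R := R) (n := n) r x, smul_eq_C_smul (R := R) (n := n) r (h.proj a x),
    h.proj_smul (C_mem_polyGrading r), sub_zero]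

/-- The projection of `M ⊗_R P` to its component of degree `a`. -/
def tensorProj (h : IsGradedModule R 𝓜) (h' : IsGradedModule R 𝓟) (a : Fin n → ℤ) :
    M ⊗[R] P →+ M ⊗[R] P :=
  TensorProduct.liftAddHom (h.tensorProjAux h' a) (by
    intro r m p
    induction m using h.induction with
    | zero => simp
    | add x y hx hy => rw [smul_add, map_add, map_add, AddMonoidHom.add_apply,
        AddMonoidHom.add_apply, hx, hy]
    | homogeneous b m hm =>
      rw [tensorProjAux_apply _ _ _ hm, tensorProjAux_apply _ _ _ (h.base_smul_mem r hm),
        h'.proj_base_smul, TensorProduct.smul_tmul])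

lemma tensorProj_tmul (h : IsGradedModule R 𝓜) (h' : IsGradedModule R 𝓟) (a : Fin n → ℤ)
    {b : Fin n → ℤ} {m : M} (hm : m ∈ 𝓜 b) (p : P) :
    h.tensorProj h' a (m ⊗ₜ[R] p) = m ⊗ₜ[R] h'.proj (a - b) p :=
  h.tensorProjAux_apply h' a hm p

lemma tensorProj_tmul_same (h : IsGradedModule R 𝓜) (h' : IsGradedModule R 𝓟)
    {b c : Fin n → ℤ} {m : M} (hm : m ∈ 𝓜 b) {p : P} (hp : p ∈ 𝓟 c) :
    h.tensorProj h' (b + c) (m ⊗ₜ[R] p) = m ⊗ₜ[R] p := by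
  rw [h.tensorProj_tmul h' _ hm, add_sub_cancel_left, h'.proj_same hp]

lemma tensorProj_tmul_ne (h : IsGradedModule R 𝓜) (h' : IsGradedModule R 𝓟)
    {a b c : Fin n → ℤ} {m : M} (hm : m ∈ 𝓜 b) {p : P} (hp : p ∈ 𝓟 c) (ha : b + c ≠ a) :
    h.tensorProj h' a (m ⊗ₜ[R] p) = 0 := by
  rw [h.tensorProj_tmul h' _ hm, h'.proj_ne hp, TensorProduct.tmul_zero]
  rintro rfl
  exact ha (add_sub_cancel b a)

lemma tensorProj_tensorProj (h : IsGradedModule R 𝓜) (h' : IsGradedModule R 𝓟)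
    (a : Fin n → ℤ) (x : M ⊗[R] P) :
    h.tensorProj h' a (h.tensorProj h' a x) = h.tensorProj h' a x := by
  induction x using h.tensor_induction h' with
  | zero => simp
  | add x y hx hy => simp [hx, hy]
  | homogeneous b c m hm p hp =>
    by_cases hbc : b + c = a
    · subst hbc
      simp only [h.tensorProj_tmul_same h' hm hp]
    · simp only [h.tensorProj_tmul_ne h' hm hp hbc, map_zero]

lemma tensorProj_of_ne (h : IsGradedModule R 𝓜) (h' : IsGradedModule R 𝓟)
    {a b : Fin n → ℤ} (hab : a ≠ b) (x : M ⊗[R] P) :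
    h.tensorProj h' b (h.tensorProj h' a x) = 0 := by
  induction x using h.tensor_induction h' with
  | zero => simp
  | add x y hx hy => simp [hx, hy]
  | homogeneous c e m hm p hp =>
    by_cases hbc : c + e = a
    · subst hbc
      rw [h.tensorProj_tmul_same h' hm hp, h.tensorProj_tmul_ne h' hm hp hab]
    · simp only [h.tensorProj_tmul_ne h' hm hp hbc, map_zero]

lemma exists_sum_tensorProj (h : IsGradedModule R 𝓜) (h' : IsGradedModule R 𝓟)
    (x : M ⊗[R] P) : ∃ s : Finset (Fin n → ℤ), ∀ t, s ⊆ t → ∑ a ∈ t, h.tensorProj h' a x = x := by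
  classical
  induction x using h.tensor_induction h' with
  | zero => exact ⟨∅, by simp⟩
  | add x y hx hy =>
    obtain ⟨s, hs⟩ := hx
    obtain ⟨s', hs'⟩ := hy
    refine ⟨s ∪ s', fun t ht => ?_⟩
    simp only [map_add, Finset.sum_add_distrib]
    rw [hs t (Finset.union_subset_left ht), hs' t (Finset.union_subset_right ht)]
  | homogeneous b c m hm p hp =>
    refine ⟨{b + c}, fun t ht => ?_⟩
    rw [Finset.sum_eq_single (b + c), h.tensorProj_tmul_same h' hm hp]
    · intro a _ ha
      exact h.tensorProj_tmul_ne h' hm hp (Ne.symm ha)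
    · intro hn
      exact absurd (ht (Finset.mem_singleton_self _)) hn

lemma tensorProj_lTensor {Q : Type u} [AddCommGroup Q] [Module (Poly R n) Q] [Module R Q]
    [IsScalarTower R (Poly R n) Q] {𝓠 : (Fin n → ℤ) → AddSubgroup Q} (h : IsGradedModule R 𝓜)
    (h' : IsGradedModule R 𝓟) (h'' : IsGradedModule R 𝓠) (f : P →ₗ[R] Q)
    (hf : ∀ a, ∀ x ∈ 𝓟 a, f x ∈ 𝓠 a) (a : Fin n → ℤ) (x : M ⊗[R] P) :
    h.tensorProj h'' a (f.lTensor M x) = f.lTensor M (h.tensorProj h' a x) := by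
  induction x using h.tensor_induction h' with
  | zero => simp
  | add x y hx hy => simp [hx, hy]
  | homogeneous b c m hm p hp =>
    rw [h.tensorProj_tmul h' a hm, LinearMap.lTensor_tmul, LinearMap.lTensor_tmul,
      h.tensorProj_tmul h'' a hm]
    exact congrArg _ (proj_map h' h'' (f := f.toAddMonoidHom) hf _ p)

end IsGradedModule

/-- The operator `X_k ⊗ 1 - 1 ⊗ X_k` on `M ⊗_R P`. -/
def diagOp (M P : Type u) [AddCommGroup M] [Module (Poly R n) M] [AddCommGroup P]
    [Module (Poly R n) P] [Module R M] [IsScalarTower R (Poly R n) M] [Module R P]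
    [IsScalarTower R (Poly R n) P] (k : Fin n) : M ⊗[R] P →ₗ[R] M ⊗[R] P :=
  (Algebra.lsmul R R M (X k : Poly R n)).rTensor P -
    (Algebra.lsmul R R P (X k : Poly R n)).lTensor M

variable {M P : Type u} [AddCommGroup M] [Module (Poly R n) M] [AddCommGroup P]
  [Module (Poly R n) P] {𝓜 : (Fin n → ℤ) → AddSubgroup M} {𝓟 : (Fin n → ℤ) → AddSubgroup P}
  [Module R M] [IsScalarTower R (Poly R n) M] [Module R P] [IsScalarTower R (Poly R n) P]

@[simp]
lemma diagOp_tmul (k : Fin n) (m : M) (p : P) :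
    diagOp (R := R) (n := n) M P k (m ⊗ₜ p) =
      ((X k : Poly R n) • m) ⊗ₜ p - m ⊗ₜ ((X k : Poly R n) • p) := rfl

lemma diagOp_comm (k l : Fin n) (x : M ⊗[R] P) :
    diagOp (n := n) M P k (diagOp (n := n) M P l x) =
      diagOp (n := n) M P l (diagOp (n := n) M P k x) := by
  induction x using TensorProduct.induction_on with
  | zero => simp
  | add x y hx hy => simp only [map_add, hx, hy]
  | tmul m p =>
    simp only [diagOp_tmul, map_sub, smul_smul, mul_comm (X k : Poly R n)]
    abel

lemma diagOp_lTensor {Q : Type u} [AddCommGroup Q] [Module (Poly R n) Q] [Module R Q]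
    [IsScalarTower R (Poly R n) Q] (f : P →ₗ[Poly R n] Q) (k : Fin n) (x : M ⊗[R] P) :
    (f.restrictScalars R).lTensor M (diagOp (n := n) M P k x) =
      diagOp (n := n) M Q k ((f.restrictScalars R).lTensor M x) := by
  induction x using TensorProduct.induction_on with
  | zero => simp
  | add x y hx hy => simp only [map_add, hx, hy]
  | tmul m p => simp

lemma tensorProj_diagOp (h : IsGradedModule R 𝓜) (h' : IsGradedModule R 𝓟) (a : Fin n → ℤ)
    (k : Fin n) (x : M ⊗[R] P) :
    h.tensorProj h' a (diagOp (n := n) M P k x) =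
      diagOp (n := n) M P k (h.tensorProj h' (a - Pi.single k 1) x) := by
  induction x using h.tensor_induction h' with
  | zero => simp
  | add x y hx hy => simp only [map_add, hx, hy]
  | homogeneous b c m hm p hp =>
    have hXm := smul_mem_of_eq h rfl (X_mem_polyGrading (R := R) k) hm
    rw [diagOp_tmul, map_sub, h.tensorProj_tmul h' _ hXm, h.tensorProj_tmul h' _ hm,
      h.tensorProj_tmul h' _ hm, diagOp_tmul, h'.proj_smul (X_mem_polyGrading k), 
      sub_right_comm a (Pi.single k 1) b, sub_sub a b, add_comm b]

end Projections

end ZnGraded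

namespace ZnGraded

/-! ### The operators `X_k ⊗ 1 - 1 ⊗ X_k` form a regular sequence on `M ⊗_R P` for free `P` -/

section Regular

variable (R : Type u) [CommRing R] (n : ℕ) (M : Type u) [AddCommGroup M]
  [Module (Poly R n) M] [Module R M] [IsScalarTower R (Poly R n) M]

/-- The involution `Y_k ↦ X_k - Y_k` of `S[Y_1, …, Y_n]`. -/
def reflection : MvPolynomial (Fin n) (Poly R n) ≃ₐ[Poly R n] MvPolynomial (Fin n) (Poly R n) :=
  AlgEquiv.ofAlgHom (aeval fun k => C (X k) - X k) (aeval fun k => C (X k) - X k)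
    (by ext k : 1; simp [MvPolynomial.algebraMap_eq])
    (by ext k : 1; simp [MvPolynomial.algebraMap_eq])

lemma reflection_X (k : Fin n) : reflection R n (X k) = C (X k) - X k := by
  simp [reflection]

/-- The identification of `M ⊗_R S` with the polynomials in `Y_1, …, Y_n` with coefficients in `M`
under which `X_k ⊗ 1 - 1 ⊗ X_k` becomes the multiplication by `Y_k`. -/
def tensorPolyEquiv : M ⊗[R] Poly R n ≃+ ((Fin n →₀ ℕ) →₀ M) :=
  (TensorProduct.AlgebraTensorModule.cancelBaseChange R (Poly R n) (Poly R n) M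
    (Poly R n)).symm.toAddEquiv.trans
  ((((((algebraTensorAlgEquiv R (Poly R n)).trans (reflection R n)).toLinearEquiv.trans
    (basisMonomials (Fin n) (Poly R n)).repr).lTensor M).trans
    (TensorProduct.finsuppScalarRight (Poly R n) (Poly R n) M (Fin n →₀ ℕ))).toAddEquiv)

lemma tensorPolyEquiv_tmul (m : M) (p : Poly R n) (u : Fin n →₀ ℕ) :
    tensorPolyEquiv R n M (m ⊗ₜ p) u =
      coeff u (reflection R n (map (algebraMap R (Poly R n)) p)) • m := by
  simp [tensorPolyEquiv]
  rfl

/-- The identification of `M ⊗_R S^(σ)` with the families of polynomials with coefficients in `M`. -/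
def tensorFreeEquiv (σ : Type u) :
    M ⊗[R] (σ →₀ Poly R n) ≃+ (σ →₀ (Fin n →₀ ℕ) →₀ M) :=
  letI := Classical.decEq σ
  (TensorProduct.finsuppRight R R M (Poly R n) σ).toAddEquiv.trans
    (Finsupp.mapRange.addEquiv (tensorPolyEquiv R n M))

variable {R n M} {σ : Type u}

lemma tensorFreeEquiv_tmul (m : M) (f : σ →₀ Poly R n) (s : σ) (u : Fin n →₀ ℕ) :
    tensorFreeEquiv R n M σ (m ⊗ₜ f) s u =
      coeff u (reflection R n (map (algebraMap R (Poly R n)) (f s))) • m := by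
  let _ := Classical.decEq σ
  rw [← tensorPolyEquiv_tmul]
  change tensorPolyEquiv R n M (TensorProduct.finsuppRight R R M (Poly R n) σ (m ⊗ₜ f) s) u = _
  rw [TensorProduct.finsuppRight_apply_tmul_apply]

lemma tensorFreeEquiv_diagOp_tmul (k : Fin n) (m : M) (f : σ →₀ Poly R n) (s : σ)
    (u : Fin n →₀ ℕ) :
    tensorFreeEquiv R n M σ (diagOp (n := n) M _ k (m ⊗ₜ f)) s u =
      coeff u (X k * reflection R n (map (algebraMap R (Poly R n)) (f s))) • m := by
  rw [diagOp_tmul, map_sub, Finsupp.sub_apply, Finsupp.sub_apply, tensorFreeEquiv_tmul,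
    tensorFreeEquiv_tmul, smul_smul, ← sub_smul, Finsupp.smul_apply, smul_eq_mul, map_mul, map_X,
    map_mul, reflection_X, sub_mul, coeff_sub, coeff_C_mul]
  congr 1
  ring

/-- With the next lemma this says that `diagOp k` acts as multiplication by `Y_k`: it shifts
coefficients by one in direction `k`, and monomials free of `Y_k` get coefficient zero. -/
lemma tensorFreeEquiv_diagOp_add (k : Fin n) (x : M ⊗[R] (σ →₀ Poly R n)) (s : σ)
    (u : Fin n →₀ ℕ) :
    tensorFreeEquiv R n M σ (diagOp (n := n) M _ k x) s (u + Finsupp.single k 1) =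
      tensorFreeEquiv R n M σ x s u := by
  induction x using TensorProduct.induction_on with
  | zero => simp
  | add x y hx hy => simp only [map_add, Finsupp.add_apply, hx, hy]
  | tmul m f =>
    rw [tensorFreeEquiv_diagOp_tmul, tensorFreeEquiv_tmul, add_comm u, coeff_X_mul]

lemma tensorFreeEquiv_diagOp_of_eq_zero (k : Fin n) (x : M ⊗[R] (σ →₀ Poly R n)) (s : σ)
    (u : Fin n →₀ ℕ) (hu : u k = 0) :
    tensorFreeEquiv R n M σ (diagOp (n := n) M _ k x) s u = 0 := by
  induction x using TensorProduct.induction_on with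
  | zero => simp
  | add x y hx hy => simp only [map_add, Finsupp.add_apply, hx, hy, add_zero]
  | tmul m f =>
    rw [tensorFreeEquiv_diagOp_tmul, coeff_X_mul', if_neg, zero_smul]
    simpa using hu

lemma tensorFreeEquiv_symm_single_add (k : Fin n) (s : σ) (u : Fin n →₀ ℕ) (m : M) :
    (tensorFreeEquiv R n M σ).symm (Finsupp.single s (Finsupp.single (u + Finsupp.single k 1) m)) =
      diagOp (n := n) M _ k
        ((tensorFreeEquiv R n M σ).symm (Finsupp.single s (Finsupp.single u m))) := by
  classical
  rw [AddEquiv.symm_apply_eq]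
  ext t v
  by_cases hv : v k = 0
  · rw [tensorFreeEquiv_diagOp_of_eq_zero _ _ _ _ hv]
    rw [Finsupp.single_apply]
    split_ifs
    · rw [Finsupp.single_eq_of_ne]
      rintro rfl
      simp at hv
    · rfl
  · obtain ⟨w, rfl⟩ : ∃ w, v = w + Finsupp.single k 1 :=
      ⟨v - Finsupp.single k 1, (tsub_add_cancel_of_le
        (by simpa [Nat.one_le_iff_ne_zero] using hv)).symm⟩
    rw [tensorFreeEquiv_diagOp_add, AddEquiv.apply_symm_apply, Finsupp.single_apply,
      Finsupp.single_apply]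
    split_ifs
    · simp [Finsupp.single_apply]
    · rfl

/-- In the coordinates `Y` the subgroup is `(Y_j : j ∈ B)` applied to families of polynomials with
coefficients in `M`, a monomial condition: every monomial that occurs is divisible by some `Y_j`
with `j ∈ B`. -/
lemma mem_sup_diagOp_iff (B : Finset (Fin n)) (x : M ⊗[R] (σ →₀ Poly R n)) :
    x ∈ B.sup (fun l => (diagOp (n := n) M (σ →₀ Poly R n) l).toAddMonoidHom.range) ↔
      ∀ s (u : Fin n →₀ ℕ), (∀ j ∈ B, u j = 0) → tensorFreeEquiv R n M σ x s u = 0 := by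
  constructor
  · intro hx s u hu
    have hle : B.sup (fun l => (diagOp (n := n) M (σ →₀ Poly R n) l).toAddMonoidHom.range) ≤
        ((Finsupp.applyAddHom u).comp ((Finsupp.applyAddHom s).comp
          (tensorFreeEquiv R n M σ).toAddMonoidHom)).ker := by
      refine Finset.sup_le fun l hl => ?_
      rintro _ ⟨y, rfl⟩
      exact tensorFreeEquiv_diagOp_of_eq_zero l y s u (hu l hl)
    exact hle hx
  · intro hx
    rw [← (tensorFreeEquiv R n M σ).symm_apply_apply x]
    set y := tensorFreeEquiv R n M σ x
    have hy : y = ∑ s ∈ y.support, ∑ u ∈ (y s).support,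
        Finsupp.single s (Finsupp.single u (y s u)) := by
      conv_lhs => rw [← Finsupp.sum_single y]
      refine Finset.sum_congr rfl fun s _ => ?_
      conv_lhs => rw [← Finsupp.sum_single (y s)]
      exact map_sum (Finsupp.singleAddHom s) _ _
    rw [hy, map_sum]
    refine sum_mem fun s _ => ?_
    rw [map_sum]
    refine sum_mem fun u _ => ?_
    by_cases hu : ∀ j ∈ B, u j = 0
    · rw [hx s u hu]
      simp
    · push Not at hu
      obtain ⟨j, hj, huj⟩ := hu
      obtain ⟨w, rfl⟩ : ∃ w, u = w + Finsupp.single j 1 :=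
        ⟨u - Finsupp.single j 1, (tsub_add_cancel_of_le
          (by simpa [Nat.one_le_iff_ne_zero] using huj)).symm⟩
      rw [tensorFreeEquiv_symm_single_add]
      exact Finset.le_sup (f := fun l =>
        (diagOp (n := n) M (σ →₀ Poly R n) l).toAddMonoidHom.range) hj ⟨_, rfl⟩

/-- Multiplication by `Y_k` with `k ∉ B` does not change the exponents in `B`, so it neither creates
nor destroys divisibility by some `Y_j`, `j ∈ B`. -/
theorem diagOp_regular (B : Finset (Fin n)) (k : Fin n) (hk : k ∉ B)
    (x : M ⊗[R] (σ →₀ Poly R n))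
    (hx : diagOp (n := n) M _ k x ∈
      B.sup (fun l => (diagOp (n := n) M (σ →₀ Poly R n) l).toAddMonoidHom.range)) :
    x ∈ B.sup (fun l => (diagOp (n := n) M (σ →₀ Poly R n) l).toAddMonoidHom.range) := by
  rw [mem_sup_diagOp_iff] at hx ⊢
  intro s u hu
  rw [← tensorFreeEquiv_diagOp_add k]
  refine hx s _ fun j hj => ?_
  have : k ≠ j := fun h => hk (h ▸ hj)
  simp [hu j hj, this.symm]

end Regular

/-! ### `M ⊗_S P` as a quotient of `M ⊗_R P` -/

section Quotient

variable {R : Type u} [CommRing R] {n : ℕ} {M P : Type u} [AddCommGroup M]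
  [Module (Poly R n) M] [Module R M] [IsScalarTower R (Poly R n) M] [AddCommGroup P]
  [Module (Poly R n) P] [Module R P] [IsScalarTower R (Poly R n) P]

variable (R n M P) in
/-- The projection of `M ⊗_R P` to `M ⊗_S P`. -/
def toTensor : M ⊗[R] P →+ M ⊗[Poly R n] P :=
  TensorProduct.liftAddHom
    (LinearMap.toAddMonoidHom'.comp (TensorProduct.mk (Poly R n) M P).toAddMonoidHom) (by
      intro r m p
      change (r • m) ⊗ₜ[Poly R n] p = m ⊗ₜ[Poly R n] (r • p)
      rw [IsGradedModule.smul_eq_C_smul (R := R) (n := n) r m,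
        IsGradedModule.smul_eq_C_smul (R := R) (n := n) r p, TensorProduct.smul_tmul])

@[simp]
lemma toTensor_tmul (m : M) (p : P) : toTensor R n M P (m ⊗ₜ[R] p) = m ⊗ₜ[Poly R n] p := rfl

lemma toTensor_surjective : Function.Surjective (toTensor R n M P) := by
  intro x
  induction x using TensorProduct.induction_on with
  | zero => exact ⟨0, map_zero _⟩
  | tmul m p => exact ⟨m ⊗ₜ p, rfl⟩
  | add x y hx hy =>
    obtain ⟨x, rfl⟩ := hx
    obtain ⟨y, rfl⟩ := hy
    exact ⟨x + y, map_add _ _ _⟩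

/-- It suffices to move one variable at a time: `f X_k m ⊗ p - m ⊗ f X_k p` is the sum of `f (X_k m)
⊗ p - X_k m ⊗ f p` and `θ_k (m ⊗ f p)`. -/
lemma smul_tmul_sub_mem (f : Poly R n) (m : M) (p : P) :
    (f • m) ⊗ₜ[R] p - m ⊗ₜ[R] (f • p) ∈
      Finset.univ.sup (fun l => (diagOp (n := n) M P l).toAddMonoidHom.range) := by
  induction f using MvPolynomial.induction_on generalizing m p with
  | C r =>
    rw [← IsGradedModule.smul_eq_C_smul (R := R) (n := n) r m,
      ← IsGradedModule.smul_eq_C_smul (R := R) (n := n) r p, TensorProduct.smul_tmul,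
      sub_self]
    exact zero_mem _
  | add f g hf hg =>
    rw [add_smul, add_smul, TensorProduct.add_tmul, TensorProduct.tmul_add, add_sub_add_comm]
    exact add_mem (hf m p) (hg m p)
  | mul_X f k hf =>
    have h1 := hf ((X k : Poly R n) • m) p
    have h2 : diagOp (n := n) M P k (m ⊗ₜ[R] (f • p)) ∈
        Finset.univ.sup (fun l => (diagOp (n := n) M P l).toAddMonoidHom.range) :=
      Finset.le_sup (f := fun l => (diagOp (n := n) M P l).toAddMonoidHom.range)
        (Finset.mem_univ k) ⟨_, rfl⟩
    have h3 := add_mem h1 h2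
    rw [diagOp_tmul, sub_add_sub_cancel, smul_smul, smul_smul] at h3
    rwa [mul_comm (X k) f] at h3

lemma toTensor_eq_zero_iff (x : M ⊗[R] P) : toTensor R n M P x = 0 ↔
    x ∈ Finset.univ.sup (fun l => (diagOp (R := R) (n := n) M P l).toAddMonoidHom.range) := by
  set J := Finset.univ.sup (fun l => (diagOp (R := R) (n := n) M P l).toAddMonoidHom.range)
  constructor
  · intro hx
    -- The quotient by `J` is `S`-balanced by `smul_tmul_sub_mem`, so the quotient map factors
    -- through `M ⊗_S P`.
    let g : M ⊗[Poly R n] P →+ (M ⊗[R] P) ⧸ J := TensorProduct.liftAddHom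
      (AddMonoidHom.mk' (fun m => (QuotientAddGroup.mk' J).comp
        (TensorProduct.mk R M P m).toAddMonoidHom) (by intro m m'; ext p; simp))
      (by
        intro f m p
        change ((f • m) ⊗ₜ[R] p : M ⊗[R] P ⧸ J) = (m ⊗ₜ[R] (f • p) : M ⊗[R] P)
        rw [eq_comm, QuotientAddGroup.eq, neg_add_eq_sub]
        exact smul_tmul_sub_mem f m p)
    have hg : ∀ y : M ⊗[R] P, g (toTensor R n M P y) = QuotientAddGroup.mk' J y := by
      intro y
      induction y using TensorProduct.induction_on with
      | zero => simp
      | add x y hx hy => rw [map_add, map_add, map_add, hx, hy]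
      | tmul m p => rfl
    have := hg x
    rw [hx, map_zero] at this
    exact (QuotientAddGroup.eq_zero_iff x).1 this.symm
  · intro hx
    have hle : J ≤ (toTensor R n M P).ker := by
      refine Finset.sup_le fun l _ => ?_
      rintro _ ⟨y, rfl⟩
      rw [AddMonoidHom.mem_ker]
      induction y using TensorProduct.induction_on with
      | zero => simp
      | add x y hx hy => rw [map_add, map_add, hx, hy, add_zero]
      | tmul m p =>
        change toTensor R n M P (diagOp M P l (m ⊗ₜ p)) = 0
        rw [diagOp_tmul, map_sub, toTensor_tmul, toTensor_tmul, TensorProduct.smul_tmul, sub_self]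
    exact hle hx

lemma toTensor_lTensor {Q : Type u} [AddCommGroup Q] [Module (Poly R n) Q] [Module R Q]
    [IsScalarTower R (Poly R n) Q] (f : P →ₗ[Poly R n] Q) (x : M ⊗[R] P) :
    toTensor R n M Q ((f.restrictScalars R).lTensor M x) = f.lTensor M (toTensor R n M P x) := by
  induction x using TensorProduct.induction_on with
  | zero => simp
  | add x y hx hy => simp only [map_add, hx, hy]
  | tmul m p => rfl

variable {𝓜 : (Fin n → ℤ) → AddSubgroup M} {𝓟 : (Fin n → ℤ) → AddSubgroup P}

lemma toTensor_tensorProj_mem (h : IsGradedModule R 𝓜) (h' : IsGradedModule R 𝓟)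
    (a : Fin n → ℤ) (x : M ⊗[R] P) :
    toTensor R n M P (h.tensorProj h' a x) ∈ tensorGrading 𝓜 𝓟 a := by
  induction x using h.tensor_induction h' with
  | zero => simp
  | add x y hx hy => rw [map_add, map_add]; exact add_mem hx hy
  | homogeneous b c m hm p hp =>
    by_cases hbc : b + c = a
    · subst hbc
      rw [h.tensorProj_tmul_same h' hm hp]
      exact AddSubgroup.subset_closure ⟨b, c, rfl, m, hm, p, hp, rfl⟩
    · rw [h.tensorProj_tmul_ne h' hm hp hbc, map_zero]
      exact zero_mem _

/-- With the previous lemma, the degree `a` part of `M ⊗_S P` is exactly the image of that of `M ⊗_R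
P`; this transfers homogeneity between the two complexes. -/
lemma exists_of_mem_tensorGrading (h : IsGradedModule R 𝓜) (h' : IsGradedModule R 𝓟)
    {a : Fin n → ℤ} {y : M ⊗[Poly R n] P} (hy : y ∈ tensorGrading 𝓜 𝓟 a) :
    ∃ x, h.tensorProj h' a x = x ∧ toTensor R n M P x = y := by
  induction hy using AddSubgroup.closure_induction with
  | mem y hy =>
    obtain ⟨b, c, rfl, m, hm, p, hp, rfl⟩ := hy
    exact ⟨m ⊗ₜ p, h.tensorProj_tmul_same h' hm hp, rfl⟩
  | zero => exact ⟨0, map_zero _, map_zero _⟩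
  | add x y _ _ hx hy =>
    obtain ⟨x, hx, rfl⟩ := hx
    obtain ⟨y, hy, rfl⟩ := hy
    exact ⟨x + y, by rw [map_add, hx, hy], map_add _ _ _⟩
  | neg x _ hx =>
    obtain ⟨x, hx, rfl⟩ := hx
    exact ⟨-x, by rw [map_neg, hx], map_neg _ _⟩

end Quotient

end ZnGraded

namespace ZnGraded

/-! ### Tensoring resolutions with flat terms -/

section Flat

variable {R : Type u} [CommRing R]

/-- Flatness of `C` keeps the kernel inside `B` after tensoring with `N`, and flatness of `B`
preserves the injection `f`. The composite `N ⊗ ker g → N' ⊗ B` is thus injective, and it factors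
through `N' ⊗ ker g`. -/
lemma flat_ker_of_surjective {B C : Type u} [AddCommGroup B] [Module R B] [AddCommGroup C]
    [Module R C] [Module.Flat R B] [Module.Flat R C] (g : B →ₗ[R] C)
    (hg : Function.Surjective g) : Module.Flat R (LinearMap.ker g) := by
  rw [Module.Flat.iff_rTensor_preserves_injective_linearMap]
  intro N N' _ _ _ _ f hf
  have h1 : Function.Injective ((LinearMap.ker g).subtype.lTensor N) :=
    LinearMap.lTensor_injective_of_exact_of_flat g hg _ (LinearMap.ker g).subtype_injective
      (LinearMap.exact_subtype_ker_map g) N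
  have h2 : Function.Injective (f.rTensor B) :=
    Module.Flat.rTensor_preserves_injective_linearMap f hf
  have h3 : ((LinearMap.ker g).subtype.lTensor N') ∘ₗ (f.rTensor (LinearMap.ker g)) =
      (f.rTensor B) ∘ₗ ((LinearMap.ker g).subtype.lTensor N) := by
    rw [LinearMap.lTensor_comp_rTensor, LinearMap.rTensor_comp_lTensor]
  have h4 := h2.comp h1
  rw [← LinearMap.coe_comp, ← h3, LinearMap.coe_comp] at h4
  exact h4.of_comp

lemma flat_range_of_flat_quotient {B C : Type u} [AddCommGroup B] [Module R B] [AddCommGroup C]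
    [Module R C] [Module.Flat R C] (g : B →ₗ[R] C) [Module.Flat R (C ⧸ LinearMap.range g)] :
    Module.Flat R (LinearMap.range g) := by
  have h := flat_ker_of_surjective (LinearMap.range g).mkQ (Submodule.mkQ_surjective _)
  rwa [Submodule.ker_mkQ] at h

/-- Right exactness handles `A → B → range g`; flatness of the cokernel of `g` makes `M ⊗ range g →
M ⊗ C` injective, so the kernel does not grow. -/
lemma lTensor_exact_of_flat_quotient {A B C : Type u} [AddCommGroup A] [Module R A]
    [AddCommGroup B] [Module R B] [AddCommGroup C] [Module R C]
    (f : A →ₗ[R] B) (g : B →ₗ[R] C) [Module.Flat R (C ⧸ LinearMap.range g)]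
    (h : Function.Exact f g) (M : Type u) [AddCommGroup M] [Module R M] :
    Function.Exact (f.lTensor M) (g.lTensor M) := by
  have hinj : Function.Injective ((LinearMap.range g).subtype.lTensor M) :=
    LinearMap.lTensor_injective_of_exact_of_flat (LinearMap.range g).mkQ
      (Submodule.mkQ_surjective _) _ (LinearMap.range g).subtype_injective
      (LinearMap.exact_subtype_mkQ _) M
  have hex : Function.Exact f g.rangeRestrict := by
    intro x
    rw [← h x, ← Subtype.coe_inj]
    rfl
  have h2 := lTensor_exact M hex g.surjective_rangeRestrict
  intro x
  rw [← h2 x, ← hinj.eq_iff' (map_zero _), ← LinearMap.comp_apply, ← LinearMap.lTensor_comp]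
  rfl

/-- By exactness the cokernel of `d (i + 1)` is the image of `d i`, which is the kernel of the
surjection from `F i` to the preceding cokernel. Flatness of `N` thus spreads to all syzygies. -/
lemma flat_quotient_range (F : ℕ → Type u) [∀ i, AddCommGroup (F i)] [∀ i, Module R (F i)]
    [∀ i, Module.Flat R (F i)] (d : ∀ i, F (i + 1) →ₗ[R] F i)
    (hd : ∀ i, Function.Exact (d (i + 1)) (d i)) (h0 : Module.Flat R (F 0 ⧸ LinearMap.range (d 0)))
    (i : ℕ) : Module.Flat R (F i ⧸ LinearMap.range (d i)) := by
  induction i with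
  | zero => exact h0
  | succ i ih =>
    have := flat_range_of_flat_quotient (d i)
    rw [← LinearMap.exact_iff.1 (hd i)]
    exact Module.Flat.of_linearEquiv (d i).quotKerEquivRange

/-- A resolution with flat terms of a module `N` stays exact in positive degrees when tensored with
`M`, provided that `M` or `N` is flat. -/
theorem lTensor_resolution_exact (F : ℕ → Type u) [∀ i, AddCommGroup (F i)] [∀ i, Module R (F i)]
    [∀ i, Module.Flat R (F i)] (d : ∀ i, F (i + 1) →ₗ[R] F i)
    (hd : ∀ i, Function.Exact (d (i + 1)) (d i)) {N : Type u} [AddCommGroup N] [Module R N]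
    (ε : F 0 →ₗ[R] N) (hε : Function.Surjective ε) (hdε : Function.Exact (d 0) ε)
    (M : Type u) [AddCommGroup M] [Module R M] (hflat : Module.Flat R M ∨ Module.Flat R N) (i : ℕ) :
    Function.Exact ((d (i + 1)).lTensor M) ((d i).lTensor M) := by
  rcases hflat with h | h
  · exact Module.Flat.lTensor_exact M (hd i)
  · have h0 : Module.Flat R (F 0 ⧸ LinearMap.range (d 0)) := by
      rw [← LinearMap.exact_iff.1 hdε]
      exact Module.Flat.of_linearEquiv (ε.quotKerEquivOfSurjective hε)
    have := flat_quotient_range F d hd h0 i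
    exact lTensor_exact_of_flat_quotient _ _ (hd i) M

end Flat

/-! ### The complex `M ⊗_R P` for the standard resolution `P` of `N` -/

section Standard

variable {R : Type u} [CommRing R] {n : ℕ}

lemma Obj.exact_d' (G : Obj R n) : Function.Exact G.syz.d.hom G.d.hom :=
  (ShortComplex.ShortExact.moduleCat_exact_iff_function_exact _).1 G.exact_d

lemma Obj.exact_aug' (G : Obj R n) : Function.Exact G.d.hom G.aug.hom :=
  (ShortComplex.ShortExact.moduleCat_exact_iff_function_exact _).1 G.exact_aug

variable {M N : Type u} [AddCommGroup M] [AddCommGroup N] [Module R M] [Module R N]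
  [Module (Poly R n) M] [Module (Poly R n) N] [IsScalarTower R (Poly R n) M]
  [IsScalarTower R (Poly R n) N]
  {𝓜 : (Fin n → ℤ) → AddSubgroup M} {𝓝 : (Fin n → ℤ) → AddSubgroup N}

/-- The terms of the standard resolution. -/
abbrev Obj.term (G : Obj R n) (i : ℕ) : Type u := (Σ b, (G.iterSyz i).grading b) →₀ Poly R n

/-- The differentials of the standard resolution. -/
def Obj.termD (G : Obj R n) (i : ℕ) : G.term (i + 1) →ₗ[Poly R n] G.term i := (G.iterSyz i).d.hom

lemma Obj.termD_mem (G : Obj R n) (i : ℕ) (a : Fin n → ℤ) (x : G.term (i + 1))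
    (hx : x ∈ coverGrading (G.iterSyz (i + 1)).grading a) :
    G.termD i x ∈ coverGrading (G.iterSyz i).grading a :=
  (G.iterSyz i).d_mem a x hx

lemma Obj.termD_exact (G : Obj R n) (i : ℕ) : Function.Exact (G.termD (i + 1)) (G.termD i) :=
  (G.iterSyz i).exact_d'

/-- If `|b| + |e| ≤ c + c'` then `|b| ≤ c` or `|e| ≤ c'`, so one factor of each homogeneous tensor
is zero. -/
lemma tensorProj_eq_zero_of_total_le (h𝓜 : IsGradedModule R 𝓜) (h𝓝 : IsGradedModule R 𝓝)
    {c c' : ℤ} (hc : ∀ a, total a ≤ c → 𝓜 a = ⊥) (hc' : ∀ a, total a ≤ c' → 𝓝 a = ⊥)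
    {a : Fin n → ℤ} (ha : total a ≤ c + c') (x : M ⊗[R] N) : h𝓜.tensorProj h𝓝 a x = 0 := by
  induction x using h𝓜.tensor_induction h𝓝 with
  | zero => simp
  | add x y hx hy => rw [map_add, hx, hy, add_zero]
  | homogeneous b e m hm p hp =>
    by_cases hbe : b + e = a
    · subst hbe
      have ht : total (b + e) = total b + total e := by simp [total, Finset.sum_add_distrib]
      rw [ht] at ha
      rcases le_or_gt (total b) c with hb | hb
      · rw [hc b hb, AddSubgroup.mem_bot] at hm
        rw [hm, TensorProduct.zero_tmul, map_zero]
      · rw [hc' e (by linarith), AddSubgroup.mem_bot] at hp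
        rw [hp, TensorProduct.tmul_zero, map_zero]
    · exact h𝓜.tensorProj_tmul_ne h𝓝 hm hp hbe

/-- The complex `M ⊗_R P` for the standard resolution `P` of `N`. -/
def standardComplex (h𝓜 : IsGradedModule R 𝓜) (h𝓝 : IsGradedModule R 𝓝)
    (hM : IsBoundedBelow 𝓜) (hN : IsBoundedBelow 𝓝)
    (hflat : Module.Flat R M ∨ Module.Flat R N) : RegularComplex.{u} n :=
  let G : Obj R n := ⟨ModuleCat.of _ N, 𝓝, h𝓝⟩
  { E := fun i => M ⊗[R] G.term i
    d := fun i => (((G.termD i).restrictScalars R).lTensor M).toAddMonoidHom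
    θ := fun k i => (diagOp (n := n) M (G.term i) k).toAddMonoidHom
    proj := fun a i => h𝓜.tensorProj (coverGrading_isGraded (G.iterSyz i).grading) a
    proj_proj := fun a i x => h𝓜.tensorProj_tensorProj _ a x
    d_θ := fun k i x => diagOp_lTensor (G.termD i) k x
    θ_θ := fun k l i x => diagOp_comm k l x
    proj_d := fun a i x => h𝓜.tensorProj_lTensor _ _ ((G.termD i).restrictScalars R)
      (G.termD_mem i) a x
    proj_θ := fun a k i x => tensorProj_diagOp h𝓜 _ a k x
    regular := fun B k hk i x hx => diagOp_regular B k hk x hx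
    exact := fun i x hx =>
      (lTensor_resolution_exact G.term (fun i => (G.termD i).restrictScalars R)
        G.termD_exact ((coverMap (R := R) 𝓝).restrictScalars R) (coverMap_surjective h𝓝)
        G.exact_aug' M hflat i x).1 hx
    d_d := fun i x => by
      change ((G.termD i).restrictScalars R).lTensor M
        (((G.termD (i + 1)).restrictScalars R).lTensor M x) = 0
      rw [← LinearMap.comp_apply, ← LinearMap.lTensor_comp]
      have h0 : (G.termD i).restrictScalars R ∘ₗ (G.termD (i + 1)).restrictScalars R = 0 :=
        LinearMap.ext fun y => (G.termD_exact i).apply_apply_eq_zero y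
      rw [h0, LinearMap.lTensor_zero, LinearMap.zero_apply]
    bounded := by
      obtain ⟨c, hc⟩ := hM
      obtain ⟨c', hc'⟩ := hN
      refine ⟨c + c', fun a ha x hx => ?_⟩
      have hex : Function.Exact ((G.termD 0).restrictScalars R)
          ((coverMap (R := R) 𝓝).restrictScalars R) := G.exact_aug'
      -- By right exactness it is enough that `x` dies in `M ⊗_R N`, whose component of degree `a`
      -- is zero.
      refine (lTensor_exact M hex (coverMap_surjective h𝓝) x).1 ?_
      have h := h𝓜.tensorProj_lTensor (coverGrading_isGraded 𝓝) h𝓝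
        ((coverMap (R := R) 𝓝).restrictScalars R) (coverMap_mem h𝓝) a x
      rw [tensorProj_eq_zero_of_total_le h𝓜 h𝓝 hc hc' ha] at h
      exact (congrArg _ hx.symm).trans h.symm }

end Standard

end ZnGraded

namespace ZnGraded

/-! ### `Tor` in terms of the cycles of `M ⊗_R P` -/

section Presentation

variable {R : Type u} [CommRing R] {n : ℕ}

/-- An element of `K.X i` is a morphism from the free module of rank one, so the universal property
of the cycles applies to it. -/
lemma exists_cycle_of_d_eq_zero (K : ChainComplex (ModuleCat.{u} (Poly R n)) ℕ) (i j : ℕ)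
    (hj : (ComplexShape.down ℕ).next i = j) (y : K.X i) (hy : (K.d i j).hom y = 0) :
    ∃ z : K.cycles i, (K.iCycles i).hom z = y := by
  let f : ModuleCat.of (Poly R n) (Poly R n) ⟶ K.X i :=
    ModuleCat.ofHom (LinearMap.toSpanSingleton _ _ y)
  have hf : f ≫ K.d i j = 0 := by
    ext
    simp [f, hy]
  refine ⟨(K.liftCycles f j hj hf).hom 1, ?_⟩
  rw [← ModuleCat.comp_apply, K.liftCycles_i f j hj hf]
  exact LinearMap.toSpanSingleton_apply_one _ _ y

lemma homologyπ_eq_zero_iff (K : ChainComplex (ModuleCat.{u} (Poly R n)) ℕ) (i : ℕ)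
    (z : K.cycles i) :
    (K.homologyπ i).hom z = 0 ↔ ∃ w, (K.d (i + 1) i).hom w = (K.iCycles i).hom z := by
  have hex := ShortComplex.exact_of_g_is_cokernel
    (ShortComplex.mk (K.toCycles (i + 1) i) (K.homologyπ i) (by simp))
    (K.homologyIsCokernel (i + 1) i (by simp))
  have hex' := (ShortComplex.ShortExact.moduleCat_exact_iff_function_exact _).1 hex
  have hinj : Function.Injective (K.iCycles i).hom :=
    (ModuleCat.mono_iff_injective _).1 inferInstance
  refine (hex' z).trans (exists_congr fun w => ?_)
  rw [← hinj.eq_iff, ← K.toCycles_i (i + 1) i]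
  rfl

variable {M N : Type u} [AddCommGroup M] [AddCommGroup N] [Module R M] [Module R N]
  [Module (Poly R n) M] [Module (Poly R n) N] [IsScalarTower R (Poly R n) M]
  [IsScalarTower R (Poly R n) N]
  {𝓜 : (Fin n → ℤ) → AddSubgroup M} {𝓝 : (Fin n → ℤ) → AddSubgroup N}
  (h𝓜 : IsGradedModule R 𝓜) (h𝓝 : IsGradedModule R 𝓝)
  (hM : IsBoundedBelow 𝓜) (hN : IsBoundedBelow 𝓝)
  (hflat : Module.Flat R M ∨ Module.Flat R N)

/-- The projection of `M ⊗_R P` to `M ⊗_S P` for the standard resolution `P` of `N`. -/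
def standardProj (i : ℕ) : (standardComplex h𝓜 h𝓝 hM hN hflat).E i →+
    ((standardResolution 𝓝 h𝓝).tensorComplex M).X i :=
  toTensor R n M (Obj.term ⟨ModuleCat.of _ N, 𝓝, h𝓝⟩ i)

/-- `t` is the class in `Tor_i^S(M, N)` of the image of `x` in `M ⊗_S P`. -/
def IsClass (i : ℕ) (x : (standardComplex h𝓜 h𝓝 hM hN hflat).E i) (t : tor R n M N i) : Prop :=
  ∃ z : ((standardResolution 𝓝 h𝓝).tensorComplex M).cycles i,
    (((standardResolution 𝓝 h𝓝).tensorComplex M).iCycles i).hom z =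
      standardProj h𝓜 h𝓝 hM hN hflat _ x ∧
    ((standardResolution 𝓝 h𝓝).cycleClass M i).hom z = t

variable {h𝓜 h𝓝 hM hN hflat}

lemma standardProj_surjective (i : ℕ) :
    Function.Surjective (standardProj h𝓜 h𝓝 hM hN hflat i) :=
  toTensor_surjective (R := R) (n := n) (M := M) (P := Obj.term ⟨ModuleCat.of _ N, 𝓝, h𝓝⟩ i)

lemma tensorComplex_d (i : ℕ) (x : (standardComplex h𝓜 h𝓝 hM hN hflat).E (i + 1)) :
    (((standardResolution 𝓝 h𝓝).tensorComplex M).d (i + 1) i).hom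
        (standardProj h𝓜 h𝓝 hM hN hflat _ x) =
      standardProj h𝓜 h𝓝 hM hN hflat _ ((standardComplex h𝓜 h𝓝 hM hN hflat).d i x) := by
  refine Eq.trans ?_
    (toTensor_lTensor (M := M) (Obj.termD ⟨ModuleCat.of _ N, 𝓝, h𝓝⟩ i) x).symm
  have hd := Obj.complex_d (R := R) ⟨ModuleCat.of _ N, 𝓝, h𝓝⟩ i
  change (((Obj.complex (R := R) ⟨ModuleCat.of _ N, 𝓝, h𝓝⟩).d (i + 1) i).hom.lTensor M) _ = _
  rw [hd]
  rfl

lemma standardProj_eq_zero_iff (i : ℕ) (x : (standardComplex h𝓜 h𝓝 hM hN hflat).E i) :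
    standardProj h𝓜 h𝓝 hM hN hflat _ x = 0 ↔
      x ∈ (standardComplex h𝓜 h𝓝 hM hN hflat).I Finset.univ i :=
  toTensor_eq_zero_iff (R := R) (n := n) (M := M) x

lemma IsClass.add {i : ℕ} {x x' : (standardComplex h𝓜 h𝓝 hM hN hflat).E i}
    {t t' : tor R n M N i} (h : IsClass h𝓜 h𝓝 hM hN hflat i x t)
    (h' : IsClass h𝓜 h𝓝 hM hN hflat i x' t') :
    IsClass h𝓜 h𝓝 hM hN hflat i (x + x') (t + t') := by
  obtain ⟨z, hz, rfl⟩ := h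
  obtain ⟨z', hz', rfl⟩ := h'
  exact ⟨z + z', by rw [map_add, hz, hz', map_add], map_add _ _ _⟩

lemma IsClass.zero (i : ℕ) : IsClass h𝓜 h𝓝 hM hN hflat i 0 0 :=
  ⟨0, by rw [map_zero, map_zero], map_zero _⟩

lemma IsClass.sum {ι : Type*} {i : ℕ} (s : Finset ι)
    (x : ι → (standardComplex h𝓜 h𝓝 hM hN hflat).E i) (t : ι → tor R n M N i)
    (h : ∀ j ∈ s, IsClass h𝓜 h𝓝 hM hN hflat i (x j) (t j)) :
    IsClass h𝓜 h𝓝 hM hN hflat i (∑ j ∈ s, x j) (∑ j ∈ s, t j) := by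
  classical
  induction s using Finset.induction_on with
  | empty => exact IsClass.zero i
  | insert j s hj ih =>
    rw [Finset.sum_insert hj, Finset.sum_insert hj]
    exact (h j (Finset.mem_insert_self _ _)).add
      (ih fun l hl => h l (Finset.mem_insert_of_mem hl))

/-- The map `M ⊗_R P → M ⊗_S P` is a surjective chain map with kernel `I univ`. Boundaries
downstairs are therefore the images of boundaries modulo all operators. -/
lemma IsClass.eq_zero_iff {i : ℕ} {x : (standardComplex h𝓜 h𝓝 hM hN hflat).E i}
    {t : tor R n M N i} (h : IsClass h𝓜 h𝓝 hM hN hflat i x t) :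
    t = 0 ↔ (standardComplex h𝓜 h𝓝 hM hN hflat).IsBoundary Finset.univ i x := by
  obtain ⟨z, hz, rfl⟩ := h
  have hiso : ((standardResolution 𝓝 h𝓝).cycleClass M i).hom z = 0 ↔
      (((standardResolution 𝓝 h𝓝).tensorComplex M).homologyπ i).hom z = 0 := by
    have hinj : Function.Injective ((standardResolution 𝓝 h𝓝).res.isoLeftDerivedObj
        ((MonoidalCategory.tensoringLeft (ModuleCat.{u} (Poly R n))).obj
          (ModuleCat.of _ M)) i).inv.hom :=
      (ModuleCat.mono_iff_injective _).1 inferInstance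
    exact hinj.eq_iff' (map_zero _)
  rw [hiso, homologyπ_eq_zero_iff, hz]
  constructor
  · rintro ⟨w, hw⟩
    obtain ⟨w, rfl⟩ := standardProj_surjective (h𝓜 := h𝓜) (hM := hM) (hN := hN)
      (hflat := hflat) (i + 1) w
    refine ⟨w, x - (standardComplex h𝓜 h𝓝 hM hN hflat).d i w, ?_, by abel⟩
    rw [← standardProj_eq_zero_iff, map_sub, ← tensorComplex_d, hw, sub_self]
  · rintro ⟨w, v, hv, rfl⟩
    refine ⟨standardProj h𝓜 h𝓝 hM hN hflat _ w, ?_⟩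
    rw [tensorComplex_d, map_add, (standardProj_eq_zero_iff i v).2 hv, add_zero]

lemma IsClass.isCycle {i : ℕ} {x : (standardComplex h𝓜 h𝓝 hM hN hflat).E i}
    {t : tor R n M N i} (h : IsClass h𝓜 h𝓝 hM hN hflat i x t) :
    (standardComplex h𝓜 h𝓝 hM hN hflat).IsCycle Finset.univ i x := by
  obtain ⟨z, hz, -⟩ := h
  cases i with
  | zero => trivial
  | succ i =>
    change _ ∈ (standardComplex h𝓜 h𝓝 hM hN hflat).I Finset.univ i
    rw [← standardProj_eq_zero_iff, ← tensorComplex_d, ← hz, ← ModuleCat.comp_apply,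
      HomologicalComplex.iCycles_d]
    rfl

lemma exists_isClass_of_isCycle {i : ℕ} {x : (standardComplex h𝓜 h𝓝 hM hN hflat).E i}
    (h : (standardComplex h𝓜 h𝓝 hM hN hflat).IsCycle Finset.univ i x) :
    ∃ t, IsClass h𝓜 h𝓝 hM hN hflat i x t := by
  obtain ⟨z, hz⟩ : ∃ z : ((standardResolution 𝓝 h𝓝).tensorComplex M).cycles i,
      (((standardResolution 𝓝 h𝓝).tensorComplex M).iCycles i).hom z = standardProj h𝓜 h𝓝 hM hN hflat _ x := by
    cases i with
    | zero =>
      refine exists_cycle_of_d_eq_zero _ 0 0 (by simp) _ ?_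
      rw [HomologicalComplex.shape _ _ _ (by simp)]
      rfl
    | succ i =>
      refine exists_cycle_of_d_eq_zero _ (i + 1) i (by simp) _ ?_
      rw [tensorComplex_d]
      exact (standardProj_eq_zero_iff i _).2 h
  exact ⟨_, z, hz, rfl⟩

variable (h𝓜 h𝓝 hM hN hflat) in
lemma exists_isClass (i : ℕ) (t : tor R n M N i) : ∃ x, IsClass h𝓜 h𝓝 hM hN hflat i x t := by
  have hsurj : Function.Surjective ((standardResolution 𝓝 h𝓝).cycleClass M i).hom :=
    by
    have h1 : Function.Surjective ((standardResolution 𝓝 h𝓝).res.isoLeftDerivedObj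
        ((MonoidalCategory.tensoringLeft (ModuleCat.{u} (Poly R n))).obj
          (ModuleCat.of _ M)) i).inv.hom :=
      (ModuleCat.epi_iff_surjective _).1 inferInstance
    have h2 : Function.Surjective
        (((standardResolution 𝓝 h𝓝).tensorComplex M).homologyπ i).hom :=
      (ModuleCat.epi_iff_surjective _).1 inferInstance
    exact h1.comp h2
  obtain ⟨z, hz⟩ := hsurj t
  obtain ⟨x, hx⟩ := standardProj_surjective (h𝓜 := h𝓜) (hM := hM) (hN := hN)
      (hflat := hflat) i
      ((((standardResolution 𝓝 h𝓝).tensorComplex M).iCycles i).hom z)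
  exact ⟨x, z, hx.symm, hz⟩

lemma mem_torComponent_iff {i : ℕ} {a : Fin n → ℤ} {t : tor R n M N i} :
    t ∈ torComponent 𝓜 h𝓝 i a ↔ ∃ x, (standardComplex h𝓜 h𝓝 hM hN hflat).proj a i x = x ∧
      IsClass h𝓜 h𝓝 hM hN hflat i x t := by
  constructor
  · rintro ⟨z, hz, rfl⟩
    obtain ⟨x, hx, hxz⟩ := exists_of_mem_tensorGrading h𝓜
      (coverGrading_isGraded (Obj.iterSyz ⟨ModuleCat.of _ N, 𝓝, h𝓝⟩ i).grading) hz
    exact ⟨x, hx, z, hxz.symm, rfl⟩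
  · rintro ⟨x, hx, z, hz, rfl⟩
    refine ⟨z, ?_, rfl⟩
    have h := toTensor_tensorProj_mem h𝓜
      (coverGrading_isGraded (Obj.iterSyz ⟨ModuleCat.of _ N, 𝓝, h𝓝⟩ i).grading) a x
    have hx' : h𝓜.tensorProj (coverGrading_isGraded
      (Obj.iterSyz ⟨ModuleCat.of _ N, 𝓝, h𝓝⟩ i).grading) a x = x := hx
    rw [hx'] at h
    exact AddSubgroup.mem_comap.2 (show (((standardResolution 𝓝 h𝓝).tensorComplex M).iCycles i).hom z
      ∈ (show AddSubgroup (((standardResolution 𝓝 h𝓝).tensorComplex M).X i) from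
        tensorGrading 𝓜 ((standardResolution 𝓝 h𝓝).grading i) a) from hz.symm ▸ h)

-- The bridge to `RegularComplex`: the counting theorem, stated for homology modulo all operators,
-- becomes a statement about `Tor`.
variable (h𝓜 h𝓝 hM hN hflat) in
lemma torComponent_ne_bot_iff (i : ℕ) (a : Fin n → ℤ) : torComponent 𝓜 h𝓝 i a ≠ ⊥ ↔
    (standardComplex h𝓜 h𝓝 hM hN hflat).NonzeroAt Finset.univ i a := by
  rw [Ne, AddSubgroup.eq_bot_iff_forall]
  push Not
  constructor
  · rintro ⟨t, ht, ht0⟩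
    obtain ⟨x, hx, hxt⟩ := (mem_torComponent_iff (h𝓜 := h𝓜) (hM := hM) (hN := hN)
      (hflat := hflat)).1 ht
    exact ⟨x, hx, hxt.isCycle, fun hb => ht0 (hxt.eq_zero_iff.2 hb)⟩
  · rintro ⟨x, hx, hcyc, hbd⟩
    obtain ⟨t, ht⟩ := exists_isClass_of_isCycle hcyc
    exact ⟨t, mem_torComponent_iff.2 ⟨x, hx, ht⟩, fun h0 => hbd (ht.eq_zero_iff.1 h0)⟩

end Presentation

end ZnGraded

namespace ZnGraded

/-! ### Independence of the components of `Tor` -/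

section BaseSMul

variable {R : Type u} [CommRing R] {n : ℕ} {M N : Type u} [AddCommGroup M] [AddCommGroup N]
  [Module (Poly R n) M] [Module (Poly R n) N]
  {𝓜 : (Fin n → ℤ) → AddSubgroup M} {𝓝 : (Fin n → ℤ) → AddSubgroup N}

lemma C_smul_mem_tensorGrading (h𝓜 : IsGradedModule R 𝓜) (r : R) {a : Fin n → ℤ}
    {y : M ⊗[Poly R n] N} (hy : y ∈ tensorGrading 𝓜 𝓝 a) :
    (C r : Poly R n) • y ∈ tensorGrading 𝓜 𝓝 a := by
  induction hy using AddSubgroup.closure_induction with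
  | mem y hy =>
    obtain ⟨b, c, hbc, m, hm, p, hp, rfl⟩ := hy
    exact AddSubgroup.subset_closure ⟨b, c, hbc, (C r : Poly R n) • m,
      smul_mem_of_eq h𝓜 (zero_add b) (C_mem_polyGrading r) hm, p, hp,
      TensorProduct.smul_tmul' _ _ _⟩
  | zero => rw [smul_zero]; exact zero_mem _
  | add x y _ _ hx hy => rw [smul_add]; exact add_mem hx hy
  | neg x _ hx => rw [smul_neg]; exact neg_mem hx

lemma C_smul_mem_torComponent (h𝓜 : IsGradedModule R 𝓜) (h𝓝 : IsGradedModule R 𝓝) (r : R)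
    {i : ℕ} {a : Fin n → ℤ} {t : tor R n M N i} (ht : t ∈ torComponent 𝓜 h𝓝 i a) :
    (C r : Poly R n) • t ∈ torComponent 𝓜 h𝓝 i a := by
  obtain ⟨z, hz, rfl⟩ := ht
  refine ⟨(C r : Poly R n) • z, ?_,
    map_smul ((standardResolution 𝓝 h𝓝).cycleClass M i).hom (C r : Poly R n) z⟩
  have h := C_smul_mem_tensorGrading h𝓜 r
    (𝓝 := (standardResolution 𝓝 h𝓝).grading i) (AddSubgroup.mem_comap.1 hz)
  have e := map_smul (((standardResolution 𝓝 h𝓝).tensorComplex M).iCycles i).hom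
    (C r : Poly R n) z
  exact AddSubgroup.mem_comap.2 (show
    (((standardResolution 𝓝 h𝓝).tensorComplex M).iCycles i).hom ((C r : Poly R n) • z)
      ∈ (show AddSubgroup (((standardResolution 𝓝 h𝓝).tensorComplex M).X i) from
        tensorGrading 𝓜 ((standardResolution 𝓝 h𝓝).grading i) a) from e.symm ▸ h)

end BaseSMul

section Independence

variable {R : Type u} [CommRing R] {n : ℕ} {M N : Type u} [AddCommGroup M] [AddCommGroup N]
  [Module R M] [Module R N]
  [Module (Poly R n) M] [Module (Poly R n) N] [IsScalarTower R (Poly R n) M]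
  [IsScalarTower R (Poly R n) N]
  {𝓜 : (Fin n → ℤ) → AddSubgroup M} {𝓝 : (Fin n → ℤ) → AddSubgroup N}

/-- With homogeneous representatives `x b`, the sum of the `x b` is a boundary modulo the operators.
Degree projections preserve such boundaries, and the one to degree `b` isolates `x b`. -/
lemma eq_zero_of_sum_torComponent_eq_zero (h𝓜 : IsGradedModule R 𝓜) (h𝓝 : IsGradedModule R 𝓝)
    (hM : IsBoundedBelow 𝓜) (hN : IsBoundedBelow 𝓝) (hflat : Module.Flat R M ∨ Module.Flat R N)
    {i : ℕ} (T : Finset (Fin n → ℤ)) (t : (Fin n → ℤ) → tor R n M N i)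
    (ht : ∀ b ∈ T, t b ∈ torComponent 𝓜 h𝓝 i b) (hsum : ∑ b ∈ T, t b = 0) :
    ∀ b ∈ T, t b = 0 := by
  classical
  have H : ∀ b, ∃ x, b ∈ T → (standardComplex h𝓜 h𝓝 hM hN hflat).proj b i x = x ∧
      IsClass h𝓜 h𝓝 hM hN hflat i x (t b) := by
    intro b
    by_cases hb : b ∈ T
    · obtain ⟨x, hx⟩ := (mem_torComponent_iff (h𝓜 := h𝓜) (hM := hM) (hN := hN)
        (hflat := hflat)).1 (ht b hb)
      exact ⟨x, fun _ => hx⟩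
    · exact ⟨0, fun h => absurd h hb⟩
  choose x hx using H
  intro b hb
  have hcl := IsClass.sum T x t fun b hb => (hx b hb).2
  have hbd := (hcl.eq_zero_iff.1 hsum).proj b
  rw [map_sum, Finset.sum_eq_single b, (hx b hb).1] at hbd
  · exact (hx b hb).2.eq_zero_iff.2 hbd
  · intro c hc hcb
    rw [← (hx c hc).1]
    exact h𝓜.tensorProj_of_ne (coverGrading_isGraded _) hcb _
  · exact fun h => absurd hb h

/-- The homogeneous parts of a representative are again cycles, because `proj` commutes with `d` and
preserves `I`. If all their classes vanished, so would the class of their sum. -/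
lemma exists_torComponent_ne_bot (h𝓜 : IsGradedModule R 𝓜) (h𝓝 : IsGradedModule R 𝓝)
    (hM : IsBoundedBelow 𝓜) (hN : IsBoundedBelow 𝓝) (hflat : Module.Flat R M ∨ Module.Flat R N)
    {i : ℕ} (hi : Nontrivial (tor R n M N i)) : ∃ a, torComponent 𝓜 h𝓝 i a ≠ ⊥ := by
  by_contra! hbot
  obtain ⟨t, ht⟩ := exists_ne (0 : tor R n M N i)
  obtain ⟨x, hx⟩ := exists_isClass h𝓜 h𝓝 hM hN hflat i t
  have hcyc : ∀ a, (standardComplex h𝓜 h𝓝 hM hN hflat).IsCycle Finset.univ i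
      ((standardComplex h𝓜 h𝓝 hM hN hflat).proj a i x) := by
    intro a
    have h := hx.isCycle
    cases i with
    | zero => trivial
    | succ i =>
      change (standardComplex h𝓜 h𝓝 hM hN hflat).d i _ ∈
        (standardComplex h𝓜 h𝓝 hM hN hflat).I Finset.univ i
      rw [← RegularComplex.proj_d]
      exact RegularComplex.proj_mem_I _ _ _ _ _ h
  obtain ⟨s, hs⟩ := h𝓜.exists_sum_tensorProj (coverGrading_isGraded
    (Obj.iterSyz ⟨ModuleCat.of _ N, 𝓝, h𝓝⟩ i).grading) x
  have hsx : ∑ a ∈ s, (standardComplex h𝓜 h𝓝 hM hN hflat).proj a i x = x := hs s subset_rfl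
  have hcl : IsClass h𝓜 h𝓝 hM hN hflat i
      (∑ a ∈ s, (standardComplex h𝓜 h𝓝 hM hN hflat).proj a i x) (∑ a ∈ s, 0) := by
    refine IsClass.sum s _ _ fun a _ => ?_
    obtain ⟨t', ht'⟩ := exists_isClass_of_isCycle (hcyc a)
    have hmem : t' ∈ torComponent 𝓜 h𝓝 i a :=
      mem_torComponent_iff.2 ⟨_, RegularComplex.proj_proj _ _ _ _, ht'⟩
    rw [hbot a, AddSubgroup.mem_bot] at hmem
    exact hmem ▸ ht'
  rw [hsx, Finset.sum_const_zero] at hcl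
  exact ht (hx.eq_zero_iff.2 (hcl.eq_zero_iff.1 rfl))

/-- One nonzero element is chosen in each degree of `T`. Scalars from `R` preserve the components,
so a linear relation holds degree by degree, and a nonzero coefficient is invertible. -/
lemma card_le_rank_tor (hR : IsField R) (h𝓜 : IsGradedModule R 𝓜) (h𝓝 : IsGradedModule R 𝓝)
    (hM : IsBoundedBelow 𝓜) (hN : IsBoundedBelow 𝓝) (hflat : Module.Flat R M ∨ Module.Flat R N)
    {i : ℕ} (T : Finset (Fin n → ℤ)) (hT : ∀ b ∈ T, torComponent 𝓜 h𝓝 i b ≠ ⊥) :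
    (T.card : Cardinal) ≤ Module.rank R
      ((ModuleCat.restrictScalars (algebraMap R (MvPolynomial (Fin n) R))).obj
        (tor R n M N i)) := by
  classical
  have := hR.nontrivial
  have H : ∀ b, ∃ t : tor R n M N i, b ∈ T → t ∈ torComponent 𝓜 h𝓝 i b ∧ t ≠ 0 := by
    intro b
    by_cases hb : b ∈ T
    · obtain ⟨t, ht⟩ := AddSubgroup.ne_bot_iff_exists_ne_zero.1 (hT b hb)
      exact ⟨t, fun _ => ⟨t.2, fun h => ht (Subtype.ext h)⟩⟩
    · exact ⟨0, fun h => absurd h hb⟩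
  choose t ht using H
  let v : T → (ModuleCat.restrictScalars (algebraMap R (MvPolynomial (Fin n) R))).obj
    (tor R n M N i) := fun b => t b
  have hv : LinearIndependent R v := by
    rw [Fintype.linearIndependent_iff]
    intro g hg b
    by_contra hgb
    -- The coefficients are extended by zero, as independence of the components is stated for
    -- families indexed by all degrees.
    let g' : (Fin n → ℤ) → R := fun b => if hb : b ∈ T then g ⟨b, hb⟩ else 0
    have hg' : ∀ b : T, g' b = g b := fun b => by simp [g']
    have hsum : ∑ b ∈ T, (C (g' b) : Poly R n) • t b = 0 := by
      rw [← Finset.sum_coe_sort]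
      refine Eq.trans (Finset.sum_congr rfl fun b _ => ?_) hg
      rw [hg']
      rfl
    have h0 := eq_zero_of_sum_torComponent_eq_zero h𝓜 h𝓝 hM hN hflat T _
      (fun b hb => C_smul_mem_torComponent h𝓜 h𝓝 (g' b) (ht b hb).1) hsum b b.2
    rw [hg'] at h0
    obtain ⟨r, hr⟩ := hR.mul_inv_cancel hgb
    refine (ht b b.2).2 ?_
    rw [← one_smul (Poly R n) (t b), ← C_1, ← hr, mul_comm, C_mul, mul_smul, h0, smul_zero]
  have hcard := hv.cardinal_lift_le_rank
  simpa using hcard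

end Independence

end ZnGraded

end

/-! ### The theorem -/

theorem theorem3p3 {R : Type u} [CommRing R] (n : ℕ)
    (M N : Type u) [AddCommGroup M] [AddCommGroup N] [Module R M] [Module R N]
    [Module (MvPolynomial (Fin n) R) M] [Module (MvPolynomial (Fin n) R) N]
    [IsScalarTower R (MvPolynomial (Fin n) R) M] [IsScalarTower R (MvPolynomial (Fin n) R) N]
    (𝓜 : (Fin n → ℤ) → AddSubgroup M) (𝓝 : (Fin n → ℤ) → AddSubgroup N)
    (h𝓜 : ZnGraded.IsGradedModule R 𝓜) (h𝓝 : ZnGraded.IsGradedModule R 𝓝)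
    (hM : ZnGraded.IsBoundedBelow 𝓜) (hN : ZnGraded.IsBoundedBelow 𝓝) :
    ((Module.Flat R M ∨ Module.Flat R N) →
      ∀ (p : ℕ) (a : Fin n → ℤ), ZnGraded.torComponent 𝓜 h𝓝 p a ≠ ⊥ →
        ∀ i : ℕ, i ≤ p → ∃ B : Finset (Fin n → ℤ), p.choose i ≤ B.card ∧
          ∀ b ∈ B, b ≤ a ∧ ZnGraded.total b ≤ ZnGraded.total a - p + i ∧
            ZnGraded.torComponent 𝓜 h𝓝 i b ≠ ⊥) ∧
    (IsField R → ∀ p : ℕ, Nontrivial (ZnGraded.tor R n M N p) →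
      ∀ i : ℕ, i ≤ p → (p.choose i : Cardinal) ≤
        Module.rank R ((ModuleCat.restrictScalars (algebraMap R (MvPolynomial (Fin n) R))).obj
          (ZnGraded.tor R n M N i))) := by

  constructor
  · intro hflat p a ha i hi
    obtain ⟨T, hT, hT'⟩ :=
      ((ZnGraded.torComponent_ne_bot_iff h𝓜 h𝓝 hM hN hflat p a).1 ha).exists_finset hi
    refine ⟨T, hT, fun b hb => ?_⟩
    obtain ⟨h1, h2, h3⟩ := hT' b hb
    exact ⟨h1, h2, (ZnGraded.torComponent_ne_bot_iff h𝓜 h𝓝 hM hN hflat i b).2 h3⟩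
  · intro hR p hp i hi
    -- Every module over a field is flat, so the hypothesis of the first part is met.
    have hflat : Module.Flat R M ∨ Module.Flat R N := by
      let _ := hR.toField
      exact Or.inl inferInstance
    obtain ⟨a, ha⟩ := ZnGraded.exists_torComponent_ne_bot h𝓜 h𝓝 hM hN hflat hp
    obtain ⟨T, hT, hT'⟩ :=
      ((ZnGraded.torComponent_ne_bot_iff h𝓜 h𝓝 hM hN hflat p a).1 ha).exists_finset hi
    exact (Nat.cast_le.2 hT).trans (ZnGraded.card_le_rank_tor hR h𝓜 h𝓝 hM hN hflat T fun b hb =>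
      (ZnGraded.torComponent_ne_bot_iff h𝓜 h𝓝 hM hN hflat i b).2 (hT' b hb).2.2)
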